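/- Let $Z=\{Z(t):t\in\mathbb R\}$ be a real-valued random process on a probability space whose trajectories are right-continuous with finite left limits, let $\mathcal F_t=\sigma(Z(u):u\le t)$, and put $z_T(s)=Z(sT)/T$ for $s\in[0,1]$, $T>0$. Let $\mathbb D=\mathbb D[0,1]$ be the space of right-continuous real functions on $[0,1]$ with finite left limits, $\|f\|=\sup_{[0,1]}|f|$, and $(f)_\varepsilon=\{g\in\mathbb D:\|g-f\|<\varepsilon\}$. Conventions. For $X_T=X_T(\omega)\in[-\infty,\infty]$ and events $C_T$, "$\limsup_{T\to\infty} X_T\le L$ uniformly over $\omega\in C_T$" means that for each $b>L$ and all sufficiently large $T$, $X_T\le b$ a.s. on $C_T$; uniform $\liminf_{T\to\infty} X_T\ge L$ is defined symmetrically, and uniform $\lim_{T\to\infty} X_T=L$ means both. A statement $\mathcal S$ involving a positive function $\varepsilon_T$ "holds for $\varepsilon_T\to0$ slowly enough" if there is a positive function $\tilde\varepsilon_T\to0$ such that $\mathcal S$ holds with $\varepsilon=\tilde\varepsilon$ and with every positive $\varepsilon_T\to0$ satisfying $\varepsilon_T\ge c\,\tilde\varepsilon_T$ (for all large $T$) for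 some constant $c>0$. Put $\ln 0=-\infty$. Condition [A]. There is a convex function $A:\mathbb R\to(-\infty,\infty]$ which is essentially smooth (the interior of $\operatorname{dom}A=\{A<\infty\}$ is non-empty, $A$ is differentiable there, and $|A'(\mu_k)|\to\infty$ whenever points $\mu_k$ of this interior converge to a finite boundary point of $\operatorname{dom}A$), such that for all $0\le s_1<s_2<\infty$, $\alpha\in\mathbb R$, $\mu\in\operatorname{dom}A$ and every positive function $\eta_T\to0$, with $T_i=s_iT$, $$\lim_{T\to\infty}\frac1{T_2-T_1}\ln\mathbf E\bigl(e^{\mu(Z(T_2)-\alpha T)}\,\big|\,\mathcal F_{T_1}\bigr)=A(\mu)\quad\text{uniformly over }\ \omega\in\{|Z(s_1T)/T-\alpha|<\eta_T\}.$$ Condition [B]. There are positive functions $V(t)=o(t)$ as $t\to\infty$ and $W(h)=o(1)$ as $h\downarrow0$ such that for all $T,\delta>0$, almost surely, $$\sup\{|Z(uT)-Z(vT)|:0\le u<v\le\min(u+\delta,1)\}\le V(T)+W(\delta)T.$$ Let $D(\alpha)=\sup_{\mu}(\alpha\mu-A(\mu))$. For $f\in\mathbb D$, the deviation integral $J(f)$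 is the common limit, over all sequences of partitions $0=s_0<\dots<s_K=1$ whose mesh tends to $0$, of $$\sum_{k=1}^{K}h_k\,D\Bigl(\frac{f(s_k)-f(s_{k-1})}{h_k}\Bigr),\qquad h_k=s_k-s_{k-1}.$$ Theorem. Assume [A], and let $f\in\mathbb D$. Then $J(f)$ exists (it may be $+\infty$), and the following hold. (i) For every positive function $\eta_T\to0$, for $\varepsilon_T\to0$ slowly enough, $$\limsup_{T\to\infty}\frac1T\ln\mathbf P\bigl(z_T\in(f)_{\varepsilon_T}\,\big|\,\mathcal F_0\bigr)\le-J(f)$$ uniformly over $\omega\in\{|Z(0)/T-f(0)|<\eta_T\}$. (ii) If, moreover, [B] holds, then for every positive function $\eta_T\to0$, for $\varepsilon_T\to0$ slowly enough, $$\lim_{T\to\infty}\frac1T\ln\mathbf P\bigl(z_T\in(f)_{\varepsilon_T}\,\big|\,\mathcal F_0\bigr)=-J(f)$$ uniformly over $\omega\in\{|Z(0)/T-f(0)|<\eta_T\}$. -/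

import Mathlib

open MeasureTheory Filter Topology Set

noncomputable section

/-! ### Convex functions with values in `(-∞, ∞]` -/

/-- The effective domain `dom A = {μ : A μ < ∞}`. -/
def effDom (A : ℝ → EReal) : Set ℝ := {μ | A μ < ⊤}

/-- `A : ℝ → (-∞, ∞]` is convex and essentially smooth: the interior of its effective domain is
non-empty, `A` is differentiable there, and `|A'(μ)| → ∞` as `μ` approaches, from within that
interior, any (finite) boundary point of the effective domain. -/
structure IsEssentiallySmoothConvex (A : ℝ → EReal) : Prop where
  ne_bot : ∀ μ, A μ ≠ ⊥
  convex : ConvexOn ℝ (effDom A) (fun μ => (A μ).toReal)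
  interior_nonempty : (interior (effDom A)).Nonempty
  differentiable : DifferentiableOn ℝ (fun μ => (A μ).toReal) (interior (effDom A))
  steep : ∀ b ∈ frontier (effDom A),
    Tendsto (fun μ => |deriv (fun ν => (A ν).toReal) μ|) (𝓝[interior (effDom A)] b) atTop

/-- The Legendre transform `D(α) = sup_μ (α μ - A(μ))`. -/
def legendre (A : ℝ → EReal) (α : ℝ) : EReal := ⨆ μ : ℝ, (((α * μ : ℝ) : EReal) - A μ)

/-! ### Trajectories -/

/-- Right-continuous functions on the line with finite left limits. -/
def IsCadlag (x : ℝ → ℝ) : Prop :=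
  ∀ t, ContinuousWithinAt x (Ici t) t ∧ ∃ l, Tendsto x (𝓝[<] t) (𝓝 l)

/-- Membership in the space `𝔻 = 𝔻[0,1]` of right-continuous functions on `[0,1]` with finite
left limits. Only the values of `f` on `[0,1]` are relevant. -/
def IsCadlagUnit (f : ℝ → ℝ) : Prop :=
  (∀ t ∈ Ico (0 : ℝ) 1, ContinuousWithinAt f (Ici t) t) ∧
    ∀ t ∈ Ioc (0 : ℝ) 1, ∃ l, Tendsto f (𝓝[<] t) (𝓝 l)

/-- The open `ε`-neighbourhood `(f)_ε` of `f` in `𝔻[0,1]` for the uniform norm on `[0,1]`. -/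
def uniformNhd (f : ℝ → ℝ) (ε : ℝ) : Set (ℝ → ℝ) :=
  {g | IsCadlagUnit g ∧ (⨆ s ∈ Icc (0 : ℝ) 1, edist (g s) (f s)) < ENNReal.ofReal ε}

/-! ### The deviation integral -/

/-- A finite partition `0 = s₀ < s₁ < ⋯ < s_n = 1` of `[0,1]`. -/
structure UnitPartition where
  n : ℕ
  pt : Fin (n + 1) → ℝ
  strictMono : StrictMono pt
  pt_zero : pt 0 = 0
  pt_last : pt (Fin.last n) = 1

/-- The length `h` of the `k`-th interval of a partition. -/
def UnitPartition.step (π : UnitPartition) (k : Fin π.n) : ℝ := π.pt k.succ - π.pt k.castSucc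

/-- The sum `∑ h_k D((f(s_k) - f(s_{k-1})) / h_k)` over the intervals of a partition. -/
def deviationSum (D : ℝ → EReal) (f : ℝ → ℝ) (π : UnitPartition) : EReal :=
  ∑ k : Fin π.n,
    (π.step k : EReal) * D ((f (π.pt k.succ) - f (π.pt k.castSucc)) / π.step k)

/-- The deviation integral of `f` exists and equals `J`: along every sequence of partitions whose
mesh tends to zero, the sums `deviationSum D f` converge to `J`. -/
def HasDeviationIntegral (D : ℝ → EReal) (f : ℝ → ℝ) (J : EReal) : Prop :=
  ∀ π : ℕ → UnitPartition,
    (∀ δ > 0, ∀ᶠ i in atTop, ∀ k : Fin (π i).n, (π i).step k < δ) →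
      Tendsto (fun i => deviationSum D f (π i)) atTop (𝓝 J)

/-! ### The process, its filtration and conditional probabilities -/

/-- The σ-algebra `ℱ_t = σ(Z(u) : u ≤ t)`. -/
abbrev pastSigma {Ω : Type*} (Z : ℝ → Ω → ℝ) (t : ℝ) : MeasurableSpace Ω :=
  ⨆ u : Iic t, MeasurableSpace.comap (Z u) inferInstance

/-- The conditional probability `P(E | m)`. -/
def condProb {Ω : Type*} [MeasurableSpace Ω] (P : Measure Ω) (m : MeasurableSpace Ω)
    (E : Set Ω) : Ω → ENNReal :=
  condLExp m P (E.indicator 1)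

/-- The rescaled trajectory `z_T(s) = Z(sT) / T`. -/
def scaledPath {Ω : Type*} (Z : ℝ → Ω → ℝ) (T : ℝ) (ω : Ω) : ℝ → ℝ := fun s => Z (s * T) ω / T

/-- The event `{|Z(sT)/T - α| < r}`. -/
def nearEvent {Ω : Type*} (Z : ℝ → Ω → ℝ) (s α T r : ℝ) : Set Ω :=
  {ω | |Z (s * T) ω / T - α| < r}

/-- `limsup_{T → ∞} X_T ≤ L` uniformly over `ω ∈ C_T`: every level above `L` is eventually a
(non-random) almost sure upper bound of `X_T` on `C_T`. For `L = -∞` this says that `X_T → -∞`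
uniformly. -/
def UniformLimsupLE {Ω : Type*} [MeasurableSpace Ω] (P : Measure Ω)
    (X : ℝ → Ω → EReal) (C : ℝ → Set Ω) (L : EReal) : Prop :=
  ∀ b, L < b → ∀ᶠ T : ℝ in atTop, ∀ᵐ ω ∂P, ω ∈ C T → X T ω ≤ b

/-- `liminf_{T → ∞} X_T ≥ L` uniformly over `ω ∈ C_T`. -/
def UniformLiminfGE {Ω : Type*} [MeasurableSpace Ω] (P : Measure Ω)
    (X : ℝ → Ω → EReal) (C : ℝ → Set Ω) (L : EReal) : Prop :=
  ∀ b, b < L → ∀ᶠ T : ℝ in atTop, ∀ᵐ ω ∂P, ω ∈ C T → b ≤ X T ω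

/-- `lim_{T → ∞} X_T = L` uniformly over `ω ∈ C_T`. For finite `L` this says that
`|X_T - L| ≤ δ_T` a.s. on `C_T` for some non-random `δ_T → 0` and all large `T`. -/
def UniformLim {Ω : Type*} [MeasurableSpace Ω] (P : Measure Ω)
    (X : ℝ → Ω → EReal) (C : ℝ → Set Ω) (L : EReal) : Prop :=
  UniformLimsupLE P X C L ∧ UniformLiminfGE P X C L

/-- A positive function tending to zero at infinity. -/
def IsPosNull (η : ℝ → ℝ) : Prop := (∀ T, 0 < η T) ∧ Tendsto η atTop (𝓝 0)

/-- The statement `S ε` is satisfied for `ε = ε_T` that tends to zero slowly enough: it holds for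
some positive `ε' → 0`, and for all positive `ε → 0` with `ε ≥ c ε'` for some constant `c > 0`. -/
def HoldsForSlow (S : (ℝ → ℝ) → Prop) : Prop :=
  ∃ ε' : ℝ → ℝ, IsPosNull ε' ∧ S ε' ∧
    ∀ ε : ℝ → ℝ, IsPosNull ε → (∃ c > 0, ∀ᶠ T in atTop, c * ε' T ≤ ε T) → S ε

/-- `1/(T₂ - T₁) · ln E(exp(μ (Z(T₂) - α T)) | ℱ_{T₁})` with `T_i = s_i T`. The conditional
expectation is that of a non-negative function, with values in `[0, ∞]`. -/
def condLogMGF {Ω : Type*} [MeasurableSpace Ω] (P : Measure Ω) (Z : ℝ → Ω → ℝ)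
    (s₁ s₂ α μ T : ℝ) (ω : Ω) : EReal :=
  ((1 / (s₂ * T - s₁ * T) : ℝ) : EReal) *
    ENNReal.log (condLExp (pastSigma Z (s₁ * T)) P
      (fun ω' => ENNReal.ofReal (Real.exp (μ * (Z (s₂ * T) ω' - α * T)))) ω)

/-- The essentially smooth convex function `A` is a common fundamental function for the
increments of `Z`. -/
structure ConditionA {Ω : Type*} [MeasurableSpace Ω] (P : Measure Ω) (Z : ℝ → Ω → ℝ)
    (A : ℝ → EReal) : Prop where
  smooth : IsEssentiallySmoothConvex A
  lim : ∀ s₁ s₂ α μ : ℝ, 0 ≤ s₁ → s₁ < s₂ → μ ∈ effDom A → ∀ η : ℝ → ℝ, IsPosNull η →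
    UniformLim P (condLogMGF P Z s₁ s₂ α μ) (fun T => nearEvent Z s₁ α T (η T)) (A μ)

/-- Almost sure control of the oscillations of the trajectories of `Z`. -/
def ConditionB {Ω : Type*} [MeasurableSpace Ω] (P : Measure Ω) (Z : ℝ → Ω → ℝ) : Prop :=
  ∃ V W : ℝ → ℝ, (∀ t > 0, 0 < V t) ∧ V =o[atTop] (fun t => t) ∧
    (∀ h > 0, 0 < W h) ∧ Tendsto W (𝓝[>] 0) (𝓝 0) ∧
    ∀ T > 0, ∀ δ > 0, ∀ᵐ ω ∂P, ∀ u v : ℝ, 0 ≤ u → u < v → v ≤ min (u + δ) 1 →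
      |Z (u * T) ω - Z (v * T) ω| ≤ V T + W δ * T

/-- `1/T · ln P(z_T ∈ (f)_ε | ℱ₀)`. -/
def condLogProb {Ω : Type*} [MeasurableSpace Ω] (P : Measure Ω) (Z : ℝ → Ω → ℝ)
    (f : ℝ → ℝ) (ε T : ℝ) (ω : Ω) : EReal :=
  ((1 / T : ℝ) : EReal) *
    ENNReal.log (condProb P (pastSigma Z 0) {ω' | scaledPath Z T ω' ∈ uniformNhd f ε} ω)

end

/-! `legendre A` is a supremum of affine functions, so a deviation sum is a supremum of expressions
`∑ (μ k * Δf k - h k * A (μ k))`. With the slopes frozen, each term telescopes over any subdivision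
and depends continuously on the values of `f`. Rounding the points of a partition up to those of a
fine one costs nothing in the limit, by right-continuity. Hence the deviation integral exists and is
the supremum of all deviation sums (`hasDeviationIntegral_iSup`).

Upper bound: a path near `f` is near `f` at the points of every partition. The exponential Markov
inequality, applied one increment at a time with frozen slopes, gives exactly the affine expressions
above (`ConditionA.exists_chain_upper`), for every radius tending to zero.

Lower bound: differentiability of `A` concentrates the exponentially tilted mass near the slope
`A'(p)`, and essential smoothness provides such slopes near every point where the Legendre transform
is finite, at no greater cost (`exists_deriv_near`, `ConditionA.exists_increment_lower`). Chaining
bounds the probability of being close to `f` on a grid. Condition [B] controls the path between grid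
points. It also controls `f`: if the integral is finite and the conditioning events are not
eventually null, paths near `f` at given points have positive probability, so `f` inherits the
modulus `W`. A diagonal choice then lets the radius shrink.

Two devices make the bounds composable. Conditional statements are integrated over sets `C` of the
past, so passing to the next increment just shrinks `C`; and [A], stated for null windows, is
converted into bounds on a window of fixed radius. -/

noncomputable section

/-! ### Slopes of essentially smooth convex functions. -/

/-- If the slopes of a convex function stay below `y` and `y μ - a μ` is bounded above, then the
slopes get arbitrarily close to `y` at non-negative points. -/
lemma exists_nonneg_deriv_gt {I : Set ℝ} {a : ℝ → ℝ} (hconv : ConvexOn ℝ I a)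
    (hdiff : ∀ x ∈ I, DifferentiableAt ℝ a x) {y d r : ℝ} (hr : 0 < r)
    (hbdd : BddAbove I → ∃ x ∈ I, y ≤ deriv a x) (hd : ∀ x ∈ I, y * x - a x ≤ d)
    (hlt : ∀ x ∈ I, deriv a x < y) : ∃ x ∈ I, 0 ≤ x ∧ y - r < deriv a x := by
  have hunb : ¬ BddAbove I := fun h => by
    obtain ⟨x, hx, hxy⟩ := hbdd h
    exact (hlt x hx).not_ge hxy
  rw [not_bddAbove_iff] at hunb
  by_contra! hcon
  obtain ⟨x₀, hx₀, hx₀pos⟩ := hunb 0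
  -- Under `hcon`, `y * x - a x` grows at rate at least `r` beyond `x₀`; this point is far enough
  -- for it to exceed `d`.
  obtain ⟨x, hx, hxgt⟩ := hunb (x₀ + max 0 ((d - (y * x₀ - a x₀)) / r))
  have hxx : x₀ < x := lt_of_le_of_lt (by linarith [le_max_left 0 ((d - (y * x₀ - a x₀)) / r)]) hxgt
  have hslope : slope a x₀ x ≤ deriv a x := hconv.slope_le_deriv hx₀ hx hxx (hdiff x hx)
  have h1 := hslope.trans (hcon x hx (hx₀pos.le.trans hxx.le))
  rw [slope_def_field, div_le_iff₀ (by linarith)] at h1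
  have h2 : (d - (y * x₀ - a x₀)) / r < x - x₀ := by
    linarith [le_max_right 0 ((d - (y * x₀ - a x₀)) / r)]
  rw [div_lt_iff₀ hr] at h2
  have := hd x hx
  nlinarith

/-- At a finite right endpoint steepness makes `|A'|` blow up, and monotonicity of `A'` excludes
blow-up to `-∞`. -/
lemma deriv_unbounded_of_bddAbove {A : ℝ → EReal} (hA : IsEssentiallySmoothConvex A)
    (hb : BddAbove (interior (effDom A))) (y : ℝ) :
    ∃ x ∈ interior (effDom A), y ≤ deriv (fun ν => (A ν).toReal) x := by
  set I := interior (effDom A) with hI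
  set a := fun ν => (A ν).toReal
  have hopen : IsOpen I := isOpen_interior
  have hdiff : ∀ x ∈ I, DifferentiableAt ℝ a x := fun x hx =>
    (hA.differentiable x hx).differentiableAt (hopen.mem_nhds hx)
  have hconv : ConvexOn ℝ I a := hA.convex.subset interior_subset hA.convex.1.interior
  obtain ⟨x₁, hx₁⟩ := hA.interior_nonempty
  have hcl : sSup I ∈ closure I := csSup_mem_closure hA.interior_nonempty hb
  have hnot : sSup I ∉ I := fun h => by
    obtain ⟨u, hu, hsub⟩ := exists_Ico_subset_of_mem_nhds (hopen.mem_nhds h) (exists_gt _)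
    obtain ⟨v, hv1, hv2⟩ := exists_between hu
    exact (le_csSup hb (hsub ⟨hv1.le, hv2⟩)).not_gt hv1
  have hfr : sSup I ∈ frontier (effDom A) := ⟨closure_mono interior_subset hcl, hnot⟩
  have : (𝓝[I] (sSup I)).NeBot := mem_closure_iff_nhdsWithin_neBot.1 hcl
  have hx₁lt : x₁ < sSup I := lt_of_le_of_ne (le_csSup hb hx₁) (fun h => hnot (h ▸ hx₁))
  have h1 : ∀ᶠ x in 𝓝[I] (sSup I), x₁ < x :=
    nhdsWithin_le_nhds (lt_mem_nhds hx₁lt)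
  obtain ⟨x, ⟨hx, hxI⟩, hxgt⟩ := (((hA.steep _ hfr).eventually_gt_atTop
    (max |y| |deriv a x₁|)).and self_mem_nhdsWithin |>.and h1).exists
  refine ⟨x, hxI, ?_⟩
  have hm := hconv.monotoneOn_deriv hdiff hx₁ hxI hxgt.le
  have h2 := (le_max_left |y| |deriv a x₁|).trans_lt hx
  have h3 := (le_max_right |y| |deriv a x₁|).trans_lt hx
  have h4 := neg_abs_le (deriv a x₁)
  rcases abs_cases (deriv a x) with ⟨h, -⟩ | ⟨h, -⟩
  · exact (le_abs_self y).trans (h ▸ h2.le)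
  · rw [h] at h3; linarith

/-- Reflection reduces the case of all slopes above `y` to that of all slopes below. -/
lemma IsEssentiallySmoothConvex.comp_neg {A : ℝ → EReal} (hA : IsEssentiallySmoothConvex A) :
    IsEssentiallySmoothConvex (fun μ => A (-μ)) := by
  have hdom : effDom (fun μ => A (-μ)) = (Homeomorph.neg ℝ) ⁻¹' effDom A := rfl
  have hint : interior (effDom (fun μ => A (-μ))) = (Homeomorph.neg ℝ) ⁻¹' interior (effDom A) := by
    rw [hdom, Homeomorph.preimage_interior]
  refine ⟨fun μ => hA.ne_bot _, ?_, ?_, ?_, ?_⟩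
  · exact hA.convex.comp_linearMap (-LinearMap.id)
  · rw [hint]
    obtain ⟨x, hx⟩ := hA.interior_nonempty
    exact ⟨-x, by simpa using hx⟩
  · rw [hint]
    exact hA.differentiable.comp differentiable_neg.differentiableOn (fun x hx => hx)
  · intro b hb
    rw [hdom, ← Homeomorph.preimage_frontier] at hb
    have hd : (fun μ => |deriv (fun ν => (A (-ν)).toReal) μ|) =
        (fun μ => |deriv (fun ν => (A ν).toReal) μ|) ∘ Neg.neg := by
      ext μ
      have := deriv_comp_neg (fun ν => (A ν).toReal) μ
      simp only [Function.comp, this, abs_neg]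
    rw [hd, hint]
    refine (hA.steep (-b) hb).comp ?_
    refine tendsto_nhdsWithin_iff.2 ⟨?_, ?_⟩
    · exact (continuous_neg.tendsto b).mono_left nhdsWithin_le_nhds
    · filter_upwards [self_mem_nhdsWithin] with x hx using hx

/-- Every point of finite Legendre transform is approximated by slopes of `A`, at which the
transform is not larger. -/
theorem exists_deriv_near {A : ℝ → EReal} (hA : IsEssentiallySmoothConvex A) {y d r : ℝ}
    (hr : 0 < r) (hd : ∀ μ ∈ effDom A, y * μ - (A μ).toReal ≤ d) :
    ∃ μ ∈ interior (effDom A), |deriv (fun ν => (A ν).toReal) μ - y| < r ∧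
      μ * deriv (fun ν => (A ν).toReal) μ - (A μ).toReal ≤ d := by
  have key : ∀ {A : ℝ → EReal} (hA : IsEssentiallySmoothConvex A) {y : ℝ}
      (hd : ∀ μ ∈ effDom A, y * μ - (A μ).toReal ≤ d)
      (hlt : ∀ x ∈ interior (effDom A), deriv (fun ν => (A ν).toReal) x < y),
      ∃ μ ∈ interior (effDom A), |deriv (fun ν => (A ν).toReal) μ - y| < r ∧
      μ * deriv (fun ν => (A ν).toReal) μ - (A μ).toReal ≤ d := by
    intro A hA y hd hlt
    obtain ⟨x, hx, hx0, hxr⟩ := exists_nonneg_deriv_gt (d := d)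
      (hA.convex.subset interior_subset hA.convex.1.interior)
      (fun x hx => (hA.differentiable x hx).differentiableAt (isOpen_interior.mem_nhds hx))
      hr (fun hb => deriv_unbounded_of_bddAbove hA hb y)
      (fun x hx => hd x (interior_subset hx)) hlt
    have h1 := hlt x hx
    refine ⟨x, hx, ?_, ?_⟩
    · rw [abs_lt]; constructor <;> linarith
    -- Because `0 ≤ x`, replacing `y` by a smaller slope can only decrease `y * x - A x`.
    · have := hd x (interior_subset hx)
      nlinarith [mul_le_mul_of_nonneg_left h1.le hx0]
  by_cases hlt : ∀ x ∈ interior (effDom A), deriv (fun ν => (A ν).toReal) x < y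
  · exact key hA hd hlt
  by_cases hgt : ∀ x ∈ interior (effDom A), y < deriv (fun ν => (A ν).toReal) x
  · have hint : ∀ x, x ∈ interior (effDom (fun μ => A (-μ))) ↔ -x ∈ interior (effDom A) := by
      intro x
      have : effDom (fun μ => A (-μ)) = (Homeomorph.neg ℝ) ⁻¹' effDom A := rfl
      rw [this, ← Homeomorph.preimage_interior]; rfl
    have hder : ∀ x, deriv (fun ν => (A (-ν)).toReal) x = -deriv (fun ν => (A ν).toReal) (-x) :=
      fun x => deriv_comp_neg (fun ν => (A ν).toReal) x
    obtain ⟨x, hx, h1, h2⟩ := key hA.comp_neg (y := -y)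
      (fun μ hμ => by have := hd (-μ) hμ; linarith)
      (fun x hx => by rw [hder]; linarith [hgt _ ((hint x).1 hx)])
    rw [hder] at h1 h2
    refine ⟨-x, (hint x).1 hx, ?_, by linarith⟩
    rw [abs_lt] at h1 ⊢
    constructor <;> linarith [h1.1, h1.2]
  push Not at hlt hgt
  obtain ⟨x₁, hx₁, h1⟩ := hlt
  obtain ⟨x₂, hx₂, h2⟩ := hgt
  -- Slopes occur on both sides of `y`, so by Darboux `y` is itself a slope.
  have hoc := hA.convex.1.interior.ordConnected.image_deriv
    (fun x hx => (hA.differentiable x hx).differentiableAt (isOpen_interior.mem_nhds hx))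
  obtain ⟨x, hx, hxy⟩ := hoc.out (mem_image_of_mem _ hx₂) (mem_image_of_mem _ hx₁) ⟨h2, h1⟩
  refine ⟨x, hx, by rw [hxy]; simpa using hr, ?_⟩
  rw [hxy, mul_comm]
  exact hd x (interior_subset hx)

/-! ### Partitions as sequences, and sums in `EReal`. -/

/-- The contribution of the interval from `u` to `v` to a deviation sum. -/
def incrCost (D : ℝ → EReal) (f : ℝ → ℝ) (u v : ℝ) : EReal :=
  ((v - u : ℝ) : EReal) * D ((f v - f u) / (v - u))

/-- The points of a partition, continued by `1`. -/
def UnitPartition.seq (π : UnitPartition) (k : ℕ) : ℝ :=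
  π.pt ⟨min k π.n, Nat.lt_succ_of_le (min_le_right _ _)⟩

lemma UnitPartition.seq_zero (π : UnitPartition) : π.seq 0 = 0 := by
  rw [← π.pt_zero]; simp [UnitPartition.seq]

lemma UnitPartition.seq_n (π : UnitPartition) : π.seq π.n = 1 := by
  rw [← π.pt_last]; simp [UnitPartition.seq, Fin.last]

lemma UnitPartition.seq_lt (π : UnitPartition) {k : ℕ} (hk : k < π.n) :
    π.seq k < π.seq (k + 1) := by
  refine π.strictMono ?_
  rw [Fin.lt_def]
  simp only
  omega

lemma UnitPartition.seq_mono (π : UnitPartition) : Monotone π.seq := by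
  intro i j hij
  refine π.strictMono.monotone ?_
  rw [Fin.le_def]
  simp only
  omega

lemma UnitPartition.seq_mem (π : UnitPartition) (k : ℕ) : π.seq k ∈ Icc (0 : ℝ) 1 := by
  constructor
  · rw [← π.pt_zero]; exact π.strictMono.monotone (Fin.zero_le _)
  · rw [← π.pt_last]; exact π.strictMono.monotone (Fin.le_last _)

lemma UnitPartition.step_eq (π : UnitPartition) (k : Fin π.n) :
    π.step k = π.seq (k + 1) - π.seq k := by
  have h1 : min ((k : ℕ) + 1) π.n = k + 1 := by omega
  have h2 : min (k : ℕ) π.n = k := by omega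
  simp only [UnitPartition.step, UnitPartition.seq, h1, h2]
  rfl

lemma deviationSum_eq (D : ℝ → EReal) (f : ℝ → ℝ) (π : UnitPartition) :
    deviationSum D f π = ∑ k ∈ Finset.range π.n, incrCost D f (π.seq k) (π.seq (k + 1)) := by
  rw [Finset.sum_range]
  refine Finset.sum_congr rfl fun k _ => ?_
  have h1 : min ((k : ℕ) + 1) π.n = k + 1 := by omega
  have h2 : min (k : ℕ) π.n = k := by omega
  simp only [incrCost, UnitPartition.step, UnitPartition.seq, h1, h2]
  rfl

lemma EReal.coe_finsetSum {ι : Type*} (s : Finset ι) (x : ι → ℝ) :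
    ((∑ i ∈ s, x i : ℝ) : EReal) = ∑ i ∈ s, (x i : EReal) := by
  classical
  induction s using Finset.induction_on with
  | empty => simp
  | insert i s hi ih => rw [Finset.sum_insert hi, Finset.sum_insert hi, EReal.coe_add, ih]

lemma EReal.exists_real_lt_add {x y b : EReal} (h : b < x + y) :
    ∃ c d : ℝ, (c : EReal) < x ∧ (d : EReal) < y ∧ b < ((c + d : ℝ) : EReal) := by
  obtain ⟨b', hb, hb'⟩ := exists_between h
  by_contra! hcon
  refine hb'.not_ge (EReal.add_le_of_forall_lt fun p hp q hq => ?_)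
  induction p with
  | bot => simp
  | top => exact absurd hp not_top_lt
  | coe p =>
    induction q with
    | bot => simp
    | top => exact absurd hq not_top_lt
    | coe q => exact (by exact_mod_cast hcon p q hp hq : ((p : EReal) + q) ≤ b).trans hb.le

/-- Real strict minorants allow a slope to be chosen on each interval separately, even where the
cost is `⊤`. -/
lemma EReal.exists_real_lt_sum (n : ℕ) (x : ℕ → EReal) {b : EReal}
    (h : b < ∑ k ∈ Finset.range n, x k) :
    ∃ c : ℕ → ℝ, (∀ k < n, (c k : EReal) < x k) ∧
      b < ((∑ k ∈ Finset.range n, c k : ℝ) : EReal) := by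
  induction n generalizing b with
  | zero => exact ⟨0, by simp, by simpa using h⟩
  | succ n ih =>
    rw [Finset.sum_range_succ] at h
    obtain ⟨p, q, hp, hq, hb⟩ := EReal.exists_real_lt_add h
    obtain ⟨c, hc, hcp⟩ := ih hp
    refine ⟨fun k => if k < n then c k else q, fun k hk => ?_, ?_⟩
    · by_cases hkn : k < n
      · simpa [hkn] using hc k hkn
      · obtain rfl : k = n := by omega
        simpa using hq
    · rw [Finset.sum_range_succ, Finset.sum_congr rfl
        (fun k hk => if_pos (Finset.mem_range.1 hk))]
      simp only [lt_irrefl, if_false]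
      refine hb.trans ?_
      exact_mod_cast add_lt_add_left (EReal.coe_lt_coe_iff.1 hcp) q

/-! ### Affine minorants and existence of the deviation integral. -/

section Legendre

variable {A : ℝ → EReal}

lemma coe_toReal_of_mem_effDom (hA : ∀ μ, A μ ≠ ⊥) {μ : ℝ} (hμ : μ ∈ effDom A) :
    (((A μ).toReal : ℝ) : EReal) = A μ :=
  EReal.coe_toReal (ne_of_lt hμ) (hA μ)

lemma le_legendre (hA : ∀ μ, A μ ≠ ⊥) {μ : ℝ} (hμ : μ ∈ effDom A) (y : ℝ) :
    ((y * μ - (A μ).toReal : ℝ) : EReal) ≤ legendre A y := by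
  refine le_trans ?_ (le_iSup (fun μ : ℝ => ((y * μ : ℝ) : EReal) - A μ) μ)
  rw [← coe_toReal_of_mem_effDom hA hμ, EReal.coe_sub, EReal.toReal_coe]

/-- Unlike the cost itself, this minorant is additive over adjacent intervals. -/
lemma le_incrCost (hA : ∀ μ, A μ ≠ ⊥) {μ : ℝ} (hμ : μ ∈ effDom A) (f : ℝ → ℝ) {u v : ℝ}
    (huv : u < v) :
    ((μ * (f v - f u) - (v - u) * (A μ).toReal : ℝ) : EReal) ≤ incrCost (legendre A) f u v := by
  have h := mul_le_mul_of_nonneg_left (le_legendre hA hμ ((f v - f u) / (v - u)))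
    (EReal.coe_nonneg.2 (sub_nonneg.2 huv.le))
  rw [← EReal.coe_mul] at h
  unfold incrCost
  convert h using 2
  have : v - u ≠ 0 := (sub_pos.2 huv).ne'
  field_simp

lemma exists_of_lt_incrCost (hA : ∀ μ, A μ ≠ ⊥) (f : ℝ → ℝ) {u v c : ℝ} (huv : u < v)
    (hc : (c : EReal) < incrCost (legendre A) f u v) :
    ∃ μ ∈ effDom A, c < μ * (f v - f u) - (v - u) * (A μ).toReal := by
  have hpos : 0 < v - u := sub_pos.2 huv
  have h1 : ((c / (v - u) : ℝ) : EReal) < legendre A ((f v - f u) / (v - u)) := by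
    by_contra! h
    refine hc.not_ge ((mul_le_mul_of_nonneg_left h (EReal.coe_nonneg.2 hpos.le)).trans ?_)
    rw [← EReal.coe_mul, mul_div_cancel₀ _ hpos.ne']
  obtain ⟨μ, hμ⟩ := lt_iSup_iff.1 h1
  have hdom : μ ∈ effDom A := by
    rw [effDom, mem_ofPred_eq, lt_top_iff_ne_top]
    intro h
    rw [h, EReal.sub_top] at hμ
    exact not_lt_bot hμ
  refine ⟨μ, hdom, ?_⟩
  rw [← coe_toReal_of_mem_effDom hA hdom, ← EReal.coe_sub, EReal.coe_lt_coe_iff,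
    div_lt_iff₀ hpos] at hμ
  calc c < _ := hμ
    _ = _ := by field_simp

lemma incrCost_ne_bot (hA : IsEssentiallySmoothConvex A) (f : ℝ → ℝ) {u v : ℝ} (huv : u < v) :
    incrCost (legendre A) f u v ≠ ⊥ := by
  obtain ⟨μ, hμ⟩ := hA.interior_nonempty
  exact ((EReal.bot_lt_coe _).trans_le (le_incrCost hA.ne_bot (interior_subset hμ) f huv)).ne'

/-- Freezing near-optimal slopes gives a real expression that is continuous in the values of `f` and
is the exponent of the Markov bound. -/
lemma exists_slopes_of_lt_deviationSum (hA : ∀ μ, A μ ≠ ⊥) (f : ℝ → ℝ) (π : UnitPartition)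
    {b : EReal} (hb : b < deviationSum (legendre A) f π) :
    ∃ μ : ℕ → ℝ, (∀ k < π.n, μ k ∈ effDom A) ∧
      b < ((∑ k ∈ Finset.range π.n, (μ k * (f (π.seq (k + 1)) - f (π.seq k)) -
        (π.seq (k + 1) - π.seq k) * (A (μ k)).toReal) : ℝ) : EReal) := by
  rw [deviationSum_eq] at hb
  obtain ⟨c, hc, hbc⟩ := EReal.exists_real_lt_sum _ _ hb
  have : ∀ k, ∃ μ, k < π.n → μ ∈ effDom A ∧ c k < μ * (f (π.seq (k + 1)) - f (π.seq k)) -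
        (π.seq (k + 1) - π.seq k) * (A μ).toReal := by
    intro k
    by_cases hk : k < π.n
    · obtain ⟨μ, h1, h2⟩ := exists_of_lt_incrCost hA f (π.seq_lt hk) (hc k hk)
      exact ⟨μ, fun _ => ⟨h1, h2⟩⟩
    · exact ⟨0, fun h => absurd h hk⟩
  choose μ hμ using this
  refine ⟨μ, fun k hk => (hμ k hk).1, hbc.trans_le (EReal.coe_le_coe_iff.2 ?_)⟩
  exact Finset.sum_le_sum fun k hk => (hμ k (Finset.mem_range.1 hk)).2.le

/-- The index of the first partition point not below `c`. -/
def UnitPartition.firstIndex (π : UnitPartition) (c : ℝ) : ℕ :=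
  sInf {j | c ≤ π.seq j}

lemma UnitPartition.le_seq_firstIndex (π : UnitPartition) {c : ℝ} (hc : c ≤ 1) :
    c ≤ π.seq (π.firstIndex c) :=
  Nat.sInf_mem (s := {j | c ≤ π.seq j}) ⟨π.n, by rw [mem_ofPred_eq, π.seq_n]; exact hc⟩

lemma UnitPartition.firstIndex_le (π : UnitPartition) {c : ℝ} {j : ℕ} (h : c ≤ π.seq j) :
    π.firstIndex c ≤ j := Nat.sInf_le h

lemma UnitPartition.firstIndex_mono (π : UnitPartition) {c d : ℝ} (hcd : c ≤ d) (hd : d ≤ 1) :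
    π.firstIndex c ≤ π.firstIndex d :=
  π.firstIndex_le (hcd.trans (π.le_seq_firstIndex hd))

lemma UnitPartition.firstIndex_zero (π : UnitPartition) : π.firstIndex 0 = 0 :=
  Nat.le_zero.1 (π.firstIndex_le π.seq_zero.ge)

lemma UnitPartition.firstIndex_one (π : UnitPartition) : π.firstIndex 1 = π.n := by
  refine le_antisymm (π.firstIndex_le π.seq_n.ge) ?_
  by_contra! h
  have := π.le_seq_firstIndex le_rfl
  have h2 := (π.seq_lt h).trans_le (π.seq_mem _).2
  linarith

lemma UnitPartition.seq_firstIndex_lt (π : UnitPartition) {c δ : ℝ} (hδ : 0 < δ)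
    (hc0 : 0 ≤ c) (hc : c ≤ 1) (hmesh : ∀ k, π.step k < δ) :
    π.seq (π.firstIndex c) < c + δ := by
  rcases Nat.eq_zero_or_pos (π.firstIndex c) with h | h
  · rw [h, π.seq_zero]; linarith
  · have hle : π.firstIndex c ≤ π.n := π.firstIndex_le (by rw [π.seq_n]; exact hc)
    have h1 : π.seq (π.firstIndex c - 1) < c := by
      by_contra! h'
      have := π.firstIndex_le h'
      omega
    have h2 := hmesh ⟨π.firstIndex c - 1, by omega⟩
    rw [π.step_eq] at h2
    simp only [Nat.sub_add_cancel h] at h2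
    linarith

lemma sum_blocks_eq_sum_range {M : Type*} [AddCommMonoid M] (g : ℕ → M) (J : ℕ → ℕ)
    (K : ℕ) (hJ : ∀ k < K, J k ≤ J (k + 1)) (h0 : J 0 = 0) :
    ∑ k ∈ Finset.range K, ∑ j ∈ Finset.Ico (J k) (J (k + 1)), g j =
      ∑ j ∈ Finset.range (J K), g j := by
  induction K with
  | zero => simp [h0]
  | succ K ih =>
    rw [Finset.sum_range_succ, ih fun k hk => hJ k (by omega),
      Finset.sum_range_add_sum_Ico _ (hJ K (by omega))]

/-- A deviation sum over `π'` dominates every affine minorant belonging to `π`, evaluated at the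
points of `π'` following those of `π`. -/
lemma slopes_le_deviationSum (hA : ∀ μ, A μ ≠ ⊥) (f : ℝ → ℝ) (π π' : UnitPartition) (μ : ℕ → ℝ)
    (hμ : ∀ k < π.n, μ k ∈ effDom A) :
    ((∑ k ∈ Finset.range π.n,
      (μ k * (f (π'.seq (π'.firstIndex (π.seq (k + 1)))) - f (π'.seq (π'.firstIndex (π.seq k)))) -
        (π'.seq (π'.firstIndex (π.seq (k + 1))) - π'.seq (π'.firstIndex (π.seq k))) *
          (A (μ k)).toReal) : ℝ) : EReal) ≤ deviationSum (legendre A) f π' := by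
  have hJ : ∀ k < π.n, π'.firstIndex (π.seq k) ≤ π'.firstIndex (π.seq (k + 1)) := fun k _ =>
    π'.firstIndex_mono (π.seq_mono (Nat.le_succ k)) (π.seq_mem _).2
  have hsum := sum_blocks_eq_sum_range
    (fun j => incrCost (legendre A) f (π'.seq j) (π'.seq (j + 1)))
    (fun k => π'.firstIndex (π.seq k)) π.n hJ (by simp [π.seq_zero, π'.firstIndex_zero])
  simp only [π.seq_n, π'.firstIndex_one] at hsum
  rw [deviationSum_eq, ← hsum, EReal.coe_finsetSum]
  refine Finset.sum_le_sum fun k hk => ?_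
  have hk := Finset.mem_range.1 hk
  have htel := Finset.sum_Ico_sub
    (fun j => μ k * f (π'.seq j) - π'.seq j * (A (μ k)).toReal) (hJ k hk)
  calc _ = ((∑ j ∈ Finset.Ico (π'.firstIndex (π.seq k)) (π'.firstIndex (π.seq (k + 1))),
        (μ k * (f (π'.seq (j + 1)) - f (π'.seq j)) -
          (π'.seq (j + 1) - π'.seq j) * (A (μ k)).toReal) : ℝ) : EReal) := by
        rw [EReal.coe_eq_coe_iff]
        refine Eq.trans ?_ (htel.symm.trans ?_)
        · ring
        · exact Finset.sum_congr rfl fun j _ => by ring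
    _ ≤ _ := by
        rw [EReal.coe_finsetSum]
        refine Finset.sum_le_sum fun j hj => le_incrCost hA (hμ k hk) f (π'.seq_lt ?_)
        have h1 := (Finset.mem_Ico.1 hj).2
        have h2 : π'.firstIndex (π.seq (k + 1)) ≤ π'.n :=
          π'.firstIndex_le (by rw [π'.seq_n]; exact (π.seq_mem _).2)
        omega

lemma IsCadlagUnit.continuousWithinAt {f : ℝ → ℝ} (hf : IsCadlagUnit f) {s : ℝ}
    (hs : s ∈ Icc (0 : ℝ) 1) : ContinuousWithinAt f (Icc s 1) s := by
  rcases eq_or_lt_of_le hs.2 with h | h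
  · rw [h, Icc_self]; exact continuousWithinAt_singleton
  · exact (hf.1 s ⟨hs.1, h⟩).mono Icc_subset_Ici_self

/-- The deviation integral exists, and is the supremum of the deviation sums. -/
theorem hasDeviationIntegral_iSup (hA : ∀ μ, A μ ≠ ⊥) {f : ℝ → ℝ} (hf : IsCadlagUnit f) :
    HasDeviationIntegral (legendre A) f (⨆ π, deviationSum (legendre A) f π) := by
  intro p hp
  rw [tendsto_order]
  refine ⟨fun b hb => ?_, fun b hb =>
    Eventually.of_forall fun i => (le_iSup (deviationSum (legendre A) f) (p i)).trans_lt hb⟩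
  obtain ⟨π, hπ⟩ := lt_iSup_iff.1 hb
  obtain ⟨μ, hμ, hbμ⟩ := exists_slopes_of_lt_deviationSum hA f π hπ
  -- Rounding is upwards because `f` is only right-continuous; at the endpoint `1` it is exact.
  have hq : ∀ k, Tendsto (fun i => (p i).seq ((p i).firstIndex (π.seq k))) atTop
      (𝓝[Icc (π.seq k) 1] (π.seq k)) := by
    intro k
    have hk := π.seq_mem k
    have hle : ∀ i, π.seq k ≤ (p i).seq ((p i).firstIndex (π.seq k)) := fun i =>
      (p i).le_seq_firstIndex hk.2
    refine tendsto_nhdsWithin_iff.2 ⟨?_, Eventually.of_forall fun i =>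
      ⟨hle i, ((p i).seq_mem _).2⟩⟩
    refine Metric.tendsto_atTop'.2 fun ε hε => ?_
    obtain ⟨N, hN⟩ := eventually_atTop.1 (hp ε hε)
    refine ⟨N, fun i hi => ?_⟩
    have := (p i).seq_firstIndex_lt hε hk.1 hk.2 (hN i hi.le)
    rw [Real.dist_eq, abs_of_nonneg (sub_nonneg.2 (hle i))]
    linarith
  have hfq : ∀ k, Tendsto (fun i => f ((p i).seq ((p i).firstIndex (π.seq k)))) atTop
      (𝓝 (f (π.seq k))) := fun k => (hf.continuousWithinAt (π.seq_mem k)).tendsto.comp (hq k)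
  have hlim := tendsto_finsetSum (Finset.range π.n) fun k _ =>
    ((((hfq (k + 1)).sub (hfq k)).const_mul (μ k)).sub
      ((((hq (k + 1)).mono_right nhdsWithin_le_nhds).sub
        ((hq k).mono_right nhdsWithin_le_nhds)).mul_const (A (μ k)).toReal))
  have hlim' := (continuous_coe_real_ereal.tendsto _).comp hlim
  filter_upwards [hlim'.eventually_const_lt hbμ] with i hi
  exact hi.trans_le (slopes_le_deviationSum hA f π (p i) μ hμ)

end Legendre

/-! ### From logarithmic conditional bounds to integrals over past events, and back. -/

section LogBounds

lemma inv_mul_log_le_iff {c b : ℝ} (hc : 0 < c) (y : ENNReal) :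
    ((1 / c : ℝ) : EReal) * ENNReal.log y ≤ (b : EReal) ↔ y ≤ ENNReal.ofReal (Real.exp (c * b)) := by
  have h1 : ((1 / c : ℝ) : EReal) * ENNReal.log y = ENNReal.log y / (c : EReal) := by
    rw [EReal.div_eq_inv_mul, one_div, EReal.coe_inv]
  rw [h1, EReal.div_le_iff_le_mul (EReal.coe_pos.2 hc) (EReal.coe_ne_top c), ← EReal.coe_mul,
    ← EReal.exp_coe, ← ENNReal.log_le_log_iff, EReal.log_exp]

lemma le_inv_mul_log_iff {c b : ℝ} (hc : 0 < c) (y : ENNReal) :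
    (b : EReal) ≤ ((1 / c : ℝ) : EReal) * ENNReal.log y ↔ ENNReal.ofReal (Real.exp (c * b)) ≤ y := by
  have h1 : ((1 / c : ℝ) : EReal) * ENNReal.log y = ENNReal.log y / (c : EReal) := by
    rw [EReal.div_eq_inv_mul, one_div, EReal.coe_inv]
  rw [h1, EReal.le_div_iff_mul_le (EReal.coe_pos.2 hc) (EReal.coe_ne_top c), ← EReal.coe_mul,
    mul_comm b c, ← EReal.exp_coe, ← ENNReal.log_le_log_iff, EReal.log_exp]

end LogBounds

section CondLExp

variable {Ω : Type*} {m m0 : MeasurableSpace Ω} {P : Measure Ω} [IsFiniteMeasure P]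
  {X : Ω → ENNReal} {c : ENNReal}

/-- In integrated form, conditioning on one more increment means replacing `C` by a smaller set of a
larger σ-algebra. -/
lemma setLIntegral_le_of_condLExp_le (hm : m ≤ m0) {C : Set Ω} (hC : MeasurableSet[m] C)
    (h : ∀ᵐ ω ∂P, ω ∈ C → condLExp m P X ω ≤ c) : ∫⁻ ω in C, X ω ∂P ≤ c * P C := by
  rw [← setLIntegral_condLExp hm P X hC, ← setLIntegral_const]
  exact setLIntegral_mono_ae' (hm _ hC) h

lemma le_setLIntegral_of_le_condLExp (hm : m ≤ m0) {C : Set Ω} (hC : MeasurableSet[m] C)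
    (h : ∀ᵐ ω ∂P, ω ∈ C → c ≤ condLExp m P X ω) : c * P C ≤ ∫⁻ ω in C, X ω ∂P := by
  rw [← setLIntegral_condLExp hm P X hC, ← setLIntegral_const]
  exact setLIntegral_mono_ae' (hm _ hC) h

/-- Integral inequalities on all past subsets of `N` determine the almost sure order; the comparison
takes place for the trimmed measure, on the σ-algebra that makes the conditional expectation
measurable. -/
lemma condLExp_le_of_setLIntegral_le (hm : m ≤ m0) {N : Set Ω} (hN : MeasurableSet[m] N)
    (h : ∀ C, MeasurableSet[m] C → C ⊆ N → ∫⁻ ω in C, X ω ∂P ≤ c * P C) :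
    ∀ᵐ ω ∂P, ω ∈ N → condLExp m P X ω ≤ c := by
  have hX := measurable_condLExp m P X
  have key : N.indicator (condLExp m P X) ≤ᵐ[P.trim hm] N.indicator (fun _ => c) := by
    refine ae_le_of_forall_setLIntegral_le_of_sigmaFinite (hX.indicator hN) fun s hs _ => ?_
    rw [setLIntegral_indicator hN, setLIntegral_indicator hN,
      setLIntegral_condLExp_trim hm _ _ (hN.inter hs), setLIntegral_const,
      trim_measurableSet_eq hm (hN.inter hs)]
    exact h _ (hN.inter hs) inter_subset_left
  filter_upwards [ae_le_of_ae_le_trim key] with ω hω hωN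
  simpa [hωN] using hω

lemma le_condLExp_of_le_setLIntegral (hm : m ≤ m0) {N : Set Ω} (hN : MeasurableSet[m] N)
    (h : ∀ C, MeasurableSet[m] C → C ⊆ N → c * P C ≤ ∫⁻ ω in C, X ω ∂P) :
    ∀ᵐ ω ∂P, ω ∈ N → c ≤ condLExp m P X ω := by
  have hX := measurable_condLExp m P X
  have key : N.indicator (fun _ => c) ≤ᵐ[P.trim hm] N.indicator (condLExp m P X) := by
    refine ae_le_of_forall_setLIntegral_le_of_sigmaFinite (measurable_const.indicator hN)
      fun s hs _ => ?_
    rw [setLIntegral_indicator hN, setLIntegral_indicator hN,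
      setLIntegral_condLExp_trim hm _ _ (hN.inter hs), setLIntegral_const,
      trim_measurableSet_eq hm (hN.inter hs)]
    exact h _ (hN.inter hs) inter_subset_left
  filter_upwards [ae_le_of_ae_le_trim key] with ω hω hωN
  simpa [hωN] using hω

end CondLExp

/-! ### A Gärtner–Ellis bound without limits. -/

section Tilting

variable {Ω : Type*} [MeasurableSpace Ω]

/-- Outside the window, one of `exp (θ (x - n (y + r)))` and `exp (θ (n (y - r) - x))` is at least
`1`. -/
lemma exp_le_tilted_tails (n p θ y r x : ℝ) (hθ : 0 ≤ θ) :
    Real.exp (p * x) ≤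
      {z : ℝ | |z - n * y| < n * r}.indicator (fun _ => Real.exp (n * (p * y + |p| * r))) x +
      (Real.exp (-(n * θ * (y + r))) * Real.exp ((p + θ) * x) +
        Real.exp (n * θ * (y - r)) * Real.exp ((p - θ) * x)) := by
  by_cases h : |x - n * y| < n * r
  · rw [indicator_of_mem (show x ∈ {z : ℝ | |z - n * y| < n * r} from h)]
    have h1 : p * x ≤ n * (p * y + |p| * r) := by
      have : p * (x - n * y) ≤ |p| * (n * r) :=
        (le_abs_self _).trans (by rw [abs_mul]; gcongr)
      linarith
    exact le_add_of_le_of_nonneg (Real.exp_le_exp.2 h1) (by positivity)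
  · rw [indicator_of_notMem (show x ∉ {z : ℝ | |z - n * y| < n * r} from h), zero_add,
      ← Real.exp_add, ← Real.exp_add]
    rw [not_lt, le_abs] at h
    rcases h with h | h
    · refine le_add_of_le_of_nonneg (Real.exp_le_exp.2 ?_) (Real.exp_nonneg _)
      nlinarith [mul_le_mul_of_nonneg_left h hθ]
    · refine le_add_of_nonneg_of_le (Real.exp_nonneg _) (Real.exp_le_exp.2 ?_)
      nlinarith [mul_le_mul_of_nonneg_left h hθ]

/-- A non-asymptotic Gärtner–Ellis lower bound: two-sided control of the exponential moments of
orders `p` and `p ± θ` bounds the mass near a point `y` from below. -/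
theorem le_measure_near_of_exp_moments (Q : Measure Ω) [IsFiniteMeasure Q] {Y : Ω → ℝ}
    (hY : Measurable Y) {n p θ y r d δ a₀ a₁ a₂ κ : ℝ} (hn : 0 < n) (hθ : 0 < θ)
    (hκ : κ ≤ θ * r / 8) (ha₁ : a₁ - a₀ - θ * y ≤ θ * r / 2)
    (ha₂ : a₂ - a₀ + θ * y ≤ θ * r / 2) (hd : p * y - a₀ ≤ d) (hpr : |p| * r + κ ≤ δ / 2)
    (hn₁ : Real.log 4 ≤ n * (θ * r / 4)) (hn₂ : Real.log 2 ≤ n * (δ / 2))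
    (h₀ : ENNReal.ofReal (Real.exp (n * (a₀ - κ))) * Q univ ≤
      ∫⁻ ω, ENNReal.ofReal (Real.exp (p * Y ω)) ∂Q)
    (h₁ : ∫⁻ ω, ENNReal.ofReal (Real.exp ((p + θ) * Y ω)) ∂Q ≤
      ENNReal.ofReal (Real.exp (n * (a₁ + κ))) * Q univ)
    (h₂ : ∫⁻ ω, ENNReal.ofReal (Real.exp ((p - θ) * Y ω)) ∂Q ≤
      ENNReal.ofReal (Real.exp (n * (a₂ + κ))) * Q univ) :
    ENNReal.ofReal (Real.exp (-(n * (d + δ)))) * Q univ ≤ Q {ω | |Y ω - n * y| < n * r} := by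
  set N := {ω | |Y ω - n * y| < n * r} with hN
  have hNm : MeasurableSet N := measurableSet_lt (by fun_prop) measurable_const
  set E := Real.exp (n * (p * y + |p| * r)) with hE
  set e₁ := Real.exp (-(n * θ * (y + r))) with he₁
  set e₂ := Real.exp (n * θ * (y - r)) with he₂
  have hEpos : 0 < E := Real.exp_pos _
  have hint : ∫⁻ ω, ENNReal.ofReal (Real.exp (p * Y ω)) ∂Q ≤
      ENNReal.ofReal E * Q N +
        (ENNReal.ofReal e₁ * ∫⁻ ω, ENNReal.ofReal (Real.exp ((p + θ) * Y ω)) ∂Q +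
          ENNReal.ofReal e₂ * ∫⁻ ω, ENNReal.ofReal (Real.exp ((p - θ) * Y ω)) ∂Q) := by
    rw [← lintegral_indicator_const hNm, ← lintegral_const_mul _ (by fun_prop),
      ← lintegral_const_mul _ (by fun_prop), ← lintegral_add_left (by fun_prop),
      ← lintegral_add_left (measurable_const.indicator hNm)]
    refine lintegral_mono fun ω => ?_
    have h := ENNReal.ofReal_le_ofReal (exp_le_tilted_tails n p θ y r (Y ω) hθ.le)
    refine h.trans (ENNReal.ofReal_add_le.trans (add_le_add ?_ ?_))
    · by_cases hω : ω ∈ N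
      · rw [indicator_of_mem hω,
          indicator_of_mem (show Y ω ∈ {z : ℝ | |z - n * y| < n * r} from hω)]
      · rw [indicator_of_notMem hω,
          indicator_of_notMem (show Y ω ∉ {z : ℝ | |z - n * y| < n * r} from hω)]
        simp
    · rw [ENNReal.ofReal_add (by positivity) (by positivity),
        ENNReal.ofReal_mul (Real.exp_nonneg _), ENNReal.ofReal_mul (Real.exp_nonneg _)]
  have hall := (h₀.trans hint).trans (add_le_add_right
    (add_le_add (mul_le_mul_right h₁ (ENNReal.ofReal e₁))
      (mul_le_mul_right h₂ (ENNReal.ofReal e₂))) _)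
  rw [← ofReal_measureReal (μ := Q) (s := univ), ← ofReal_measureReal (μ := Q) (s := N)] at hall ⊢
  have hM : 0 ≤ Q.real univ := measureReal_nonneg
  have hq : 0 ≤ Q.real N := measureReal_nonneg
  rw [← ENNReal.ofReal_mul (by positivity), ← ENNReal.ofReal_mul (by positivity),
    ← ENNReal.ofReal_mul (by positivity), ← ENNReal.ofReal_mul (by positivity),
    ← ENNReal.ofReal_mul (by positivity), ← ENNReal.ofReal_mul (by positivity),
    ← ENNReal.ofReal_add (by positivity) (by positivity),
    ← ENNReal.ofReal_add (by positivity) (by positivity),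
    ENNReal.ofReal_le_ofReal_iff (by positivity)] at hall
  rw [← ENNReal.ofReal_mul (by positivity)]
  refine ENNReal.ofReal_le_ofReal ?_
  have hquarter : ∀ x : ℝ, x ≤ n * (a₀ - κ) - Real.log 4 →
      Real.exp x ≤ Real.exp (n * (a₀ - κ)) / 4 := fun x hx => by
    have := Real.exp_le_exp.2 hx
    rwa [Real.exp_sub, Real.exp_log (by norm_num)] at this
  -- The tail gains `θ r` and loses at most `θ r / 2` to `ha₁` and `2 κ ≤ θ r / 4`; the remaining `n
  -- θ r / 4 ≥ log 4` makes it a quarter of the lower bound for the moment of order `p`.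
  have k₁ : e₁ * Real.exp (n * (a₁ + κ)) ≤ Real.exp (n * (a₀ - κ)) / 4 := by
    rw [he₁, ← Real.exp_add]
    refine hquarter _ ?_
    nlinarith [mul_le_mul_of_nonneg_left ha₁ hn.le, mul_le_mul_of_nonneg_left hκ hn.le]
  have k₂ : e₂ * Real.exp (n * (a₂ + κ)) ≤ Real.exp (n * (a₀ - κ)) / 4 := by
    rw [he₂, ← Real.exp_add]
    refine hquarter _ ?_
    nlinarith [mul_le_mul_of_nonneg_left ha₂ hn.le, mul_le_mul_of_nonneg_left hκ hn.le]
  -- The two tails leave at least half of that lower bound to the window, where the integrand is at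
  -- most `E`.
  have k₃ : E * Real.exp (-(n * (d + δ))) ≤ Real.exp (n * (a₀ - κ)) / 2 := by
    have : E * Real.exp (-(n * (d + δ))) ≤ Real.exp (n * (a₀ - κ) - Real.log 2) := by
      rw [hE, ← Real.exp_add]
      refine Real.exp_le_exp.2 ?_
      nlinarith [mul_le_mul_of_nonneg_left hd hn.le, mul_le_mul_of_nonneg_left hpr hn.le]
    rwa [Real.exp_sub, Real.exp_log (by norm_num)] at this
  have m₁ := mul_le_mul_of_nonneg_right k₁ hM
  have m₂ := mul_le_mul_of_nonneg_right k₂ hM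
  have m₃ := mul_le_mul_of_nonneg_right k₃ hM
  refine le_of_mul_le_mul_left ?_ hEpos
  linarith

end Tilting

/-! ### From null windows to a fixed radius. -/

/-- An eventual property of all positive null functions holds for a constant. -/
lemma exists_radius_of_forall_isPosNull {p : ℝ → ℝ → Prop}
    (h : ∀ η, IsPosNull η → ∀ᶠ T in atTop, p T (η T)) : ∃ ρ > 0, ∀ᶠ T in atTop, p T ρ := by
  by_contra! hcon
  have hex : ∀ n : ℕ, ∃ T : ℝ, (n : ℝ) ≤ T ∧ ¬ p T (1 / ((n : ℝ) + 1)) := fun n => by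
    have h1 := hcon (1 / ((n : ℝ) + 1)) (by positivity)
    obtain ⟨T, hT1, hT2⟩ := (h1.and_eventually (eventually_ge_atTop (n : ℝ))).exists
    exact ⟨T, hT2, hT1⟩
  choose τ hτ hp using hex
  classical
  -- The contradicting function equals `1 / (n + 1)` at the bad time `τ n`. If several `n` share
  -- that time, any of them serves, as `p` fails for each.
  set η : ℝ → ℝ := fun T =>
    if h : ∃ n, τ n = T then 1 / ((h.choose : ℝ) + 1) else 1 / (|T| + 1) with hη
  have hnull : IsPosNull η := by
    refine ⟨fun T => ?_, Metric.tendsto_atTop.2 fun ε hε => ?_⟩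
    · simp only [hη]; split_ifs <;> positivity
    obtain ⟨N, hN⟩ := exists_nat_one_div_lt hε
    -- Past this threshold `T` differs from every `τ n` with `n ≤ N`, so the chosen index exceeds
    -- `N`.
    refine ⟨∑ n ∈ Finset.range (N + 1), |τ n| + N + 1, fun T hT => ?_⟩
    have hsum : 0 ≤ ∑ n ∈ Finset.range (N + 1), |τ n| := Finset.sum_nonneg fun _ _ => abs_nonneg _
    have hpos : 0 < η T := by simp only [hη]; split_ifs <;> positivity
    rw [Real.dist_eq, sub_zero, abs_of_pos hpos]
    refine lt_of_le_of_lt ?_ hN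
    simp only [hη]
    split_ifs with hT'
    · refine one_div_le_one_div_of_le (by positivity) ?_
      have hspec := hT'.choose_spec
      set k := hT'.choose
      have : N < k := by
        by_contra! hk
        have h1 := Finset.single_le_sum (f := fun n => |τ n|) (fun _ _ => abs_nonneg _)
          (Finset.mem_range.2 (Nat.lt_succ_of_le hk))
        have h2 := le_abs_self (τ k)
        have h3 : (0 : ℝ) ≤ N := N.cast_nonneg
        linarith
      have : (N : ℝ) ≤ k := by exact_mod_cast this.le
      linarith
    · refine one_div_le_one_div_of_le (by positivity) ?_
      have := le_abs_self T
      linarith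
  obtain ⟨T₀, hT₀⟩ := eventually_atTop.1 (h η hnull)
  obtain ⟨n, hn⟩ := exists_nat_ge T₀
  have hT' : ∃ k, τ k = τ n := ⟨n, rfl⟩
  have h1 := hT₀ (τ n) (hn.trans (hτ n))
  have h2 := hp hT'.choose
  rw [hT'.choose_spec] at h2
  simp only [hη, dif_pos hT'] at h1
  exact h2 h1

/-! ### Bounds for one increment. -/

section Events

variable {Ω : Type*} {Z : ℝ → Ω → ℝ}

lemma pastSigma_mono {s t : ℝ} (h : s ≤ t) : pastSigma Z s ≤ pastSigma Z t :=
  iSup_le fun u => le_iSup (fun v : Iic t => MeasurableSpace.comap (Z v) inferInstance)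
    ⟨u, u.2.trans h⟩

lemma measurableSet_nearEvent (s α T r : ℝ) :
    MeasurableSet[pastSigma Z (s * T)] (nearEvent Z s α T r) := by
  refine le_iSup (fun v : Iic (s * T) => MeasurableSpace.comap (Z v) inferInstance)
    ⟨s * T, mem_Iic.2 le_rfl⟩ _ ⟨{z : ℝ | |z / T - α| < r}, ?_, rfl⟩
  exact measurableSet_lt (by fun_prop) measurable_const

lemma nearEvent_mono {s α T r r' : ℝ} (h : r ≤ r') : nearEvent Z s α T r ⊆ nearEvent Z s α T r' :=
  fun _ hω => lt_of_lt_of_le hω h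

end Events

section Increments

variable {Ω : Type*} [MeasurableSpace Ω] {P : Measure Ω} [IsProbabilityMeasure P]
  {Z : ℝ → Ω → ℝ} {A : ℝ → EReal}

lemma pastSigma_le (hZ : ∀ t, Measurable (Z t)) (t : ℝ) :
    pastSigma Z t ≤ (inferInstance : MeasurableSpace Ω) :=
  iSup_le fun u => (hZ u).comap_le

lemma ConditionA.exists_exp_moment_bounds (hZ : ∀ t, Measurable (Z t)) (hA : ConditionA P Z A)
    {s₁ s₂ μ : ℝ} (hs₁ : 0 ≤ s₁) (hs : s₁ < s₂) (hμ : μ ∈ effDom A) (α : ℝ) {δ : ℝ} (hδ : 0 < δ) :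
    ∃ ρ > 0, ∀ᶠ T in atTop, ∀ C, MeasurableSet[pastSigma Z (s₁ * T)] C →
      C ⊆ nearEvent Z s₁ α T ρ →
      ENNReal.ofReal (Real.exp ((s₂ - s₁) * T * ((A μ).toReal - δ))) * P C ≤
        ∫⁻ ω in C, ENNReal.ofReal (Real.exp (μ * (Z (s₂ * T) ω - α * T))) ∂P ∧
      ∫⁻ ω in C, ENNReal.ofReal (Real.exp (μ * (Z (s₂ * T) ω - α * T))) ∂P ≤
        ENNReal.ofReal (Real.exp ((s₂ - s₁) * T * ((A μ).toReal + δ))) * P C := by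
  have hcoe := coe_toReal_of_mem_effDom hA.smooth.ne_bot hμ
  obtain ⟨ρ, hρ, h⟩ := exists_radius_of_forall_isPosNull
    (p := fun T ρ => ∀ᵐ ω ∂P, ω ∈ nearEvent Z s₁ α T ρ →
      (((A μ).toReal - δ : ℝ) : EReal) ≤ condLogMGF P Z s₁ s₂ α μ T ω ∧
      condLogMGF P Z s₁ s₂ α μ T ω ≤ (((A μ).toReal + δ : ℝ) : EReal)) (fun η hη => by
    obtain ⟨hup, hlo⟩ := hA.lim s₁ s₂ α μ hs₁ hs hμ η hη
    have h1 := hup (((A μ).toReal + δ : ℝ) : EReal)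
      (by nth_rewrite 1 [← hcoe]; exact EReal.coe_lt_coe_iff.2 (by linarith))
    have h2 := hlo (((A μ).toReal - δ : ℝ) : EReal)
      (by nth_rewrite 2 [← hcoe]; exact EReal.coe_lt_coe_iff.2 (by linarith))
    filter_upwards [h1, h2] with T hT1 hT2
    filter_upwards [hT1, hT2] with ω hω1 hω2 hω
    exact ⟨hω2 hω, hω1 hω⟩)
  refine ⟨ρ, hρ, ?_⟩
  filter_upwards [h, eventually_gt_atTop 0] with T hT hTpos C hC hCsub
  have hpos : 0 < s₂ * T - s₁ * T := by rw [← sub_mul]; exact mul_pos (sub_pos.2 hs) hTpos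
  have hm := pastSigma_le hZ (s₁ * T)
  rw [sub_mul s₂ s₁ T]
  constructor
  · refine le_setLIntegral_of_le_condLExp hm hC ?_
    filter_upwards [hT] with ω hω hωC
    exact (le_inv_mul_log_iff hpos _).1 (hω (hCsub hωC)).1
  · refine setLIntegral_le_of_condLExp_le hm hC ?_
    filter_upwards [hT] with ω hω hωC
    exact (inv_mul_log_le_iff hpos _).1 (hω (hCsub hωC)).2

/-- The exponential Markov bound for one increment, uniformly over the past. -/
lemma ConditionA.exists_increment_upper (hZ : ∀ t, Measurable (Z t)) (hA : ConditionA P Z A)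
    {s₁ s₂ μ : ℝ} (hs₁ : 0 ≤ s₁) (hs : s₁ < s₂) (hμ : μ ∈ effDom A) (α β : ℝ) {δ : ℝ}
    (hδ : 0 < δ) :
    ∃ ρ > 0, ∀ᶠ T in atTop, ∀ C, MeasurableSet[pastSigma Z (s₁ * T)] C →
      C ⊆ nearEvent Z s₁ α T ρ →
      P (C ∩ nearEvent Z s₂ β T ρ) ≤
        ENNReal.ofReal (Real.exp (T * ((s₂ - s₁) * (A μ).toReal - μ * (β - α) + δ))) * P C := by
  have hh : 0 < s₂ - s₁ := sub_pos.2 hs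
  obtain ⟨ρ, hρ, h⟩ := hA.exists_exp_moment_bounds hZ hs₁ hs hμ α
    (δ := δ / (2 * (s₂ - s₁))) (by positivity)
  -- Half of `δ` pays for the exponential moment, half for `μ * (Z/T - β)` on the window; the `+ 1`
  -- avoids division by zero.
  refine ⟨min ρ (δ / (2 * (|μ| + 1))), lt_min hρ (by positivity), ?_⟩
  filter_upwards [h, eventually_gt_atTop 0] with T hT hTpos C hC hCsub
  have hm := pastSigma_le hZ (s₁ * T)
  have hNm := pastSigma_le hZ (s₂ * T) _
    (measurableSet_nearEvent (Z := Z) s₂ β T (min ρ (δ / (2 * (|μ| + 1)))))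
  set N := nearEvent Z s₂ β T (min ρ (δ / (2 * (|μ| + 1)))) with hN
  have h2 := (hT C hC (hCsub.trans (nearEvent_mono (min_le_left _ _)))).2
  calc P (C ∩ N) = ∫⁻ ω in C, N.indicator 1 ω ∂P := by
        rw [lintegral_indicator_one hNm, Measure.restrict_apply hNm, inter_comm]
    _ ≤ ∫⁻ ω in C, ENNReal.ofReal (Real.exp (T * (δ / 2 - μ * (β - α)))) *
          ENNReal.ofReal (Real.exp (μ * (Z (s₂ * T) ω - α * T))) ∂P := by
        refine lintegral_mono fun ω => ?_
        by_cases hω : ω ∈ N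
        · rw [indicator_of_mem hω, Pi.one_apply, ← ENNReal.ofReal_mul (Real.exp_nonneg _),
            ← Real.exp_add, ENNReal.one_le_ofReal, Real.one_le_exp_iff]
          have h3 : |Z (s₂ * T) ω / T - β| < δ / (2 * (|μ| + 1)) :=
            lt_of_lt_of_le hω (min_le_right _ _)
          have h4 : |μ * (Z (s₂ * T) ω / T - β)| ≤ δ / 2 := by
            rw [abs_mul]
            calc |μ| * |Z (s₂ * T) ω / T - β| ≤ (|μ| + 1) * (δ / (2 * (|μ| + 1))) := by
                  gcongr; linarith
              _ = δ / 2 := by field_simp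
          have h5 : μ * (Z (s₂ * T) ω - α * T) =
              T * (μ * (Z (s₂ * T) ω / T - β) + μ * (β - α)) := by
            field_simp; ring
          rw [h5, ← mul_add]
          have := (abs_le.1 h4).1
          exact mul_nonneg hTpos.le (by linarith)
        · rw [indicator_of_notMem hω]; exact zero_le
    _ ≤ _ := by
        have hmeas := hZ (s₂ * T)
        rw [lintegral_const_mul _ (by fun_prop)]
        refine (mul_le_mul_right h2 _).trans (le_of_eq ?_)
        rw [← mul_assoc, ← ENNReal.ofReal_mul (Real.exp_nonneg _), ← Real.exp_add]
        congr 3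
        field_simp
        ring

/-- The Gärtner–Ellis bound for one increment, uniformly over the past. -/
lemma ConditionA.exists_increment_lower (hZ : ∀ t, Measurable (Z t)) (hA : ConditionA P Z A)
    {s₁ s₂ : ℝ} (hs₁ : 0 ≤ s₁) (hs : s₁ < s₂) {α β d : ℝ}
    (hd : legendre A ((β - α) / (s₂ - s₁)) ≤ d) {r δ : ℝ} (hr : 0 < r) (hδ : 0 < δ) :
    ∃ ρ > 0, ∀ᶠ T in atTop, ∀ C, MeasurableSet[pastSigma Z (s₁ * T)] C →
      C ⊆ nearEvent Z s₁ α T ρ →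
      ENNReal.ofReal (Real.exp (-(T * ((s₂ - s₁) * d + δ)))) * P C ≤
        P (C ∩ nearEvent Z s₂ β T r) := by
  have hh : 0 < s₂ - s₁ := sub_pos.2 hs
  set h := s₂ - s₁ with hh_def
  set a := fun μ => (A μ).toReal with ha
  -- The exact slope may not be attained; over a duration `h`, an error below `r / (2 * h)` moves
  -- the endpoint by less than `r / 2`.
  obtain ⟨p, hp, hpy, hpd⟩ := exists_deriv_near hA.smooth (y := (β - α) / h) (d := d)
    (r := r / (2 * h)) (by positivity)
    (fun μ hμ => EReal.coe_le_coe_iff.1 ((le_legendre hA.smooth.ne_bot hμ _).trans hd))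
  set y := deriv a p with hy
  set r' := min (r / (2 * h)) (δ / h / (4 * (|p| + 1))) with hr'
  have hr'pos : 0 < r' := lt_min (by positivity) (by positivity)
  have hder : HasDerivAt a y p :=
    ((hA.smooth.differentiable p hp).differentiableAt (isOpen_interior.mem_nhds hp)).hasDerivAt
  -- Differentiability at `p` is the source of concentration: for small `θ` the remainders at `p ±
  -- θ` are at most `θ * r' / 2`.
  obtain ⟨ε, hε, hball⟩ := Metric.eventually_nhds_iff_ball.1
    ((hder.isLittleO.def (half_pos hr'pos)).and (isOpen_interior.mem_nhds hp))
  set θ := ε / 2 with hθ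
  have hθpos : 0 < θ := half_pos hε
  have hplus := hball (p + θ) (by
    rw [Metric.mem_ball, Real.dist_eq, add_sub_cancel_left, abs_of_pos hθpos]; linarith)
  have hminus := hball (p - θ) (by
    rw [Metric.mem_ball, Real.dist_eq, sub_sub_cancel_left, abs_neg, abs_of_pos hθpos]; linarith)
  have ha₁ : a (p + θ) - a p - θ * y ≤ θ * r' / 2 := by
    have := hplus.1
    rw [add_sub_cancel_left, Real.norm_eq_abs, Real.norm_eq_abs, abs_of_pos hθpos,
      smul_eq_mul] at this
    linarith [le_abs_self (a (p + θ) - a p - θ * y)]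
  have ha₂ : a (p - θ) - a p + θ * y ≤ θ * r' / 2 := by
    have := hminus.1
    rw [sub_sub_cancel_left, Real.norm_eq_abs, Real.norm_eq_abs, abs_neg, abs_of_pos hθpos,
      smul_eq_mul] at this
    linarith [le_abs_self (a (p - θ) - a p - -θ * y)]
  set κ := min (θ * r' / 8) (δ / h / 4) with hκ
  have hκpos : 0 < κ := lt_min (by positivity) (by positivity)
  have hpr : |p| * r' + κ ≤ δ / h / 2 := by
    have h1 : |p| * r' ≤ δ / h / 4 :=
      calc |p| * r' ≤ (|p| + 1) * (δ / h / (4 * (|p| + 1))) := by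
            gcongr
            · linarith
            · exact min_le_right _ _
        _ = δ / h / 4 := by field_simp
    linarith [min_le_right (θ * r' / 8) (δ / h / 4)]
  obtain ⟨ρ₀, hρ₀, H₀⟩ := hA.exists_exp_moment_bounds hZ hs₁ hs (interior_subset hp) α hκpos
  obtain ⟨ρ₁, hρ₁, H₁⟩ := hA.exists_exp_moment_bounds hZ hs₁ hs (interior_subset hplus.2) α hκpos
  obtain ⟨ρ₂, hρ₂, H₂⟩ := hA.exists_exp_moment_bounds hZ hs₁ hs (interior_subset hminus.2) α hκpos
  have hlarge : ∀ M c : ℝ, 0 < c → ∀ᶠ T : ℝ in atTop, M ≤ h * T * c := fun M c hc =>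
    ((tendsto_id.const_mul_atTop hh).atTop_mul_const hc).eventually_ge_atTop M
  refine ⟨min ρ₀ (min ρ₁ ρ₂), by positivity, ?_⟩
  filter_upwards [H₀, H₁, H₂, eventually_gt_atTop 0,
    hlarge (Real.log 4) (θ * r' / 4) (by positivity),
    hlarge (Real.log 2) (δ / h / 2) (by positivity)] with T H₀ H₁ H₂ hT hn₁ hn₂ C hC hCsub
  have hCm := pastSigma_le hZ _ _ hC
  have hzm := hZ (s₂ * T)
  have b₀ := (H₀ C hC (hCsub.trans (nearEvent_mono (min_le_left _ _)))).1
  have b₁ := (H₁ C hC (hCsub.trans (nearEvent_mono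
    ((min_le_right _ _).trans (min_le_left _ _))))).2
  have b₂ := (H₂ C hC (hCsub.trans (nearEvent_mono
    ((min_le_right _ _).trans (min_le_right _ _))))).2
  rw [← Measure.restrict_apply_univ C] at b₀ b₁ b₂
  have hGE := le_measure_near_of_exp_moments (P.restrict C)
    (Y := fun ω => Z (s₂ * T) ω - α * T) (by fun_prop) (n := h * T) (mul_pos hh hT) hθpos
    (min_le_left _ _) ha₁ ha₂ hpd hpr hn₁ hn₂ b₀ b₁ b₂
  rw [Measure.restrict_apply_univ] at hGE
  have hexp : -(h * T * (d + δ / h)) = -(T * (h * d + δ)) := by field_simp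
  rw [hexp] at hGE
  refine hGE.trans ?_
  rw [Measure.restrict_apply (measurableSet_lt (by fun_prop) measurable_const), inter_comm]
  refine measure_mono (inter_subset_inter_right _ fun ω hω => ?_)
  have hω : |Z (s₂ * T) ω - α * T - h * T * y| < h * T * r' := hω
  change |Z (s₂ * T) ω / T - β| < r
  have e₁ : Z (s₂ * T) ω / T - β =
      (Z (s₂ * T) ω - α * T - h * T * y) / T + h * (y - (β - α) / h) := by
    field_simp; ring
  rw [e₁]
  refine (abs_add_le _ _).trans_lt ?_
  rw [abs_div, abs_mul, abs_of_pos hT, abs_of_pos hh]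
  have e₂ : |Z (s₂ * T) ω - α * T - h * T * y| / T < h * r' := by
    rw [div_lt_iff₀ hT]; linarith
  have e₃ : h * r' ≤ r / 2 :=
    calc h * r' ≤ h * (r / (2 * h)) := by gcongr; exact min_le_left _ _
      _ = r / 2 := by field_simp
  have e₄ : h * |y - (β - α) / h| < r / 2 :=
    calc h * |y - (β - α) / h| < h * (r / (2 * h)) := by gcongr
      _ = r / 2 := by field_simp
  linarith

end Increments

/-! ### Chaining finitely many increments. -/

section ChainEvent

variable {Ω : Type*} {Z : ℝ → Ω → ℝ}

/-- The scaled trajectory is within `r` of `f` at the points `s 0, …, s K`. -/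
def chainEvent (Z : ℝ → Ω → ℝ) (f : ℝ → ℝ) (s : ℕ → ℝ) (K : ℕ) (T r : ℝ) : Set Ω :=
  ⋂ j ∈ Finset.range (K + 1), nearEvent Z (s j) (f (s j)) T r

lemma chainEvent_succ (f : ℝ → ℝ) (s : ℕ → ℝ) (K : ℕ) (T r : ℝ) :
    chainEvent Z f s (K + 1) T r =
      chainEvent Z f s K T r ∩ nearEvent Z (s (K + 1)) (f (s (K + 1))) T r := by
  rw [chainEvent, Finset.range_add_one, Finset.set_biInter_insert, inter_comm]
  rfl

lemma chainEvent_zero (f : ℝ → ℝ) (s : ℕ → ℝ) (T r : ℝ) :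
    chainEvent Z f s 0 T r = nearEvent Z (s 0) (f (s 0)) T r := by
  simp [chainEvent]

lemma chainEvent_mono (f : ℝ → ℝ) (s : ℕ → ℝ) (K : ℕ) (T : ℝ) {r r' : ℝ} (h : r ≤ r') :
    chainEvent Z f s K T r ⊆ chainEvent Z f s K T r' :=
  iInter₂_mono fun _ _ => nearEvent_mono h

lemma chainEvent_subset (f : ℝ → ℝ) (s : ℕ → ℝ) {K j : ℕ} (hj : j ≤ K) (T r : ℝ) :
    chainEvent Z f s K T r ⊆ nearEvent Z (s j) (f (s j)) T r :=
  biInter_subset_of_mem (Finset.mem_coe.2 (Finset.mem_range.2 (Nat.lt_succ_of_le hj)))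

lemma measurableSet_chainEvent (f : ℝ → ℝ) {s : ℕ → ℝ} (hs : Monotone s) (K : ℕ) {T : ℝ}
    (hT : 0 ≤ T) (r : ℝ) : MeasurableSet[pastSigma Z (s K * T)] (chainEvent Z f s K T r) :=
  Finset.measurableSet_biInter _ fun _ hj =>
    pastSigma_mono (mul_le_mul_of_nonneg_right
      (hs (Nat.lt_succ_iff.1 (Finset.mem_range.1 hj))) hT) _ (measurableSet_nearEvent _ _ _ _)

end ChainEvent

section Chain

variable {Ω : Type*} [MeasurableSpace Ω] {P : Measure Ω} [IsProbabilityMeasure P]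
  {Z : ℝ → Ω → ℝ} {A : ℝ → EReal}

/-- The exponential Markov bound for finitely many increments. -/
theorem ConditionA.exists_chain_upper (hZ : ∀ t, Measurable (Z t)) (hA : ConditionA P Z A)
    (f : ℝ → ℝ) {s : ℕ → ℝ} (hs : Monotone s) (hs0 : 0 ≤ s 0) (K : ℕ)
    (hlt : ∀ k < K, s k < s (k + 1)) {μ : ℕ → ℝ} (hμ : ∀ k < K, μ k ∈ effDom A) {δ : ℝ}
    (hδ : 0 < δ) :
    ∃ ρ > 0, ∀ᶠ T in atTop, ∀ C, MeasurableSet[pastSigma Z (s 0 * T)] C →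
      C ⊆ nearEvent Z (s 0) (f (s 0)) T ρ →
      P (C ∩ chainEvent Z f s K T ρ) ≤
        ENNReal.ofReal (Real.exp (T * (δ - ∑ k ∈ Finset.range K,
          (μ k * (f (s (k + 1)) - f (s k)) - (s (k + 1) - s k) * (A (μ k)).toReal)))) * P C := by
  induction K generalizing δ with
  | zero =>
    refine ⟨1, one_pos, ?_⟩
    filter_upwards [eventually_ge_atTop 0] with T hT C hC hCsub
    refine (measure_mono inter_subset_left).trans (le_mul_of_one_le_left' ?_)
    rw [ENNReal.one_le_ofReal, Real.one_le_exp_iff]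
    simpa using mul_nonneg hT hδ.le
  | succ K ih =>
    obtain ⟨ρ₁, hρ₁, h₁⟩ := ih (fun k hk => hlt k (by omega)) (fun k hk => hμ k (by omega))
      (half_pos hδ)
    obtain ⟨ρ₂, hρ₂, h₂⟩ := hA.exists_increment_upper hZ (hs0.trans (hs (Nat.zero_le K)))
      (hlt K (by omega)) (hμ K (by omega)) (f (s K)) (f (s (K + 1))) (half_pos hδ)
    refine ⟨min ρ₁ ρ₂, lt_min hρ₁ hρ₂, ?_⟩
    filter_upwards [h₁, h₂, eventually_ge_atTop 0] with T h₁ h₂ hT C hC hCsub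
    have b₁ := h₁ C hC (hCsub.trans (nearEvent_mono (min_le_left _ _)))
    -- The event of the first `K` increments belongs to the past of the next one and joins the
    -- conditioning set.
    have b₂ := h₂ (C ∩ chainEvent Z f s K T (min ρ₁ ρ₂))
      ((pastSigma_mono (mul_le_mul_of_nonneg_right (hs (Nat.zero_le K)) hT) _ hC).inter
        (measurableSet_chainEvent f hs K hT _))
      (inter_subset_right.trans ((chainEvent_subset f s le_rfl _ _).trans
        (nearEvent_mono (min_le_right _ _))))
    calc P (C ∩ chainEvent Z f s (K + 1) T (min ρ₁ ρ₂))
        ≤ P (C ∩ chainEvent Z f s K T (min ρ₁ ρ₂) ∩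
            nearEvent Z (s (K + 1)) (f (s (K + 1))) T ρ₂) := by
          rw [chainEvent_succ, ← inter_assoc]
          exact measure_mono (inter_subset_inter_right _ (nearEvent_mono (min_le_right _ _)))
      _ ≤ _ := b₂
      _ ≤ _ := mul_le_mul_right ((measure_mono (inter_subset_inter_right _
          (chainEvent_mono f s K T (min_le_left _ _)))).trans b₁) _
      _ = _ := by
          rw [← mul_assoc, ← ENNReal.ofReal_mul (Real.exp_nonneg _), ← Real.exp_add,
            Finset.sum_range_succ]
          congr 3
          ring

/-- The Gärtner–Ellis bound for finitely many increments. -/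
theorem ConditionA.exists_chain_lower (hZ : ∀ t, Measurable (Z t)) (hA : ConditionA P Z A)
    (f : ℝ → ℝ) {s : ℕ → ℝ} (hs : Monotone s) (hs0 : 0 ≤ s 0) (K : ℕ)
    (hlt : ∀ k < K, s k < s (k + 1)) {d : ℕ → ℝ}
    (hd : ∀ k < K, legendre A ((f (s (k + 1)) - f (s k)) / (s (k + 1) - s k)) ≤ d k) {r δ : ℝ}
    (hr : 0 < r) (hδ : 0 < δ) :
    ∃ ρ > 0, ∀ᶠ T in atTop, ∀ C, MeasurableSet[pastSigma Z (s 0 * T)] C →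
      C ⊆ nearEvent Z (s 0) (f (s 0)) T ρ →
      ENNReal.ofReal (Real.exp (-(T * (∑ k ∈ Finset.range K, (s (k + 1) - s k) * d k + δ)))) *
        P C ≤ P (C ∩ chainEvent Z f s K T r) := by
  induction K generalizing r δ with
  | zero =>
    refine ⟨r, hr, ?_⟩
    filter_upwards [eventually_ge_atTop 0] with T hT C hC hCsub
    rw [chainEvent_zero, inter_eq_self_of_subset_left hCsub]
    refine mul_le_of_le_one_left' ?_
    rw [ENNReal.ofReal_le_one, Real.exp_le_one_iff]
    simpa using mul_nonneg hT hδ.le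
  | succ K ih =>
    -- Radii are chosen backwards: the last increment dictates `ρ₂`, and the earlier ones must land
    -- within `min r ρ₂`.
    obtain ⟨ρ₂, hρ₂, h₂⟩ := hA.exists_increment_lower hZ (hs0.trans (hs (Nat.zero_le K)))
      (hlt K (by omega)) (hd K (by omega)) hr (half_pos hδ)
    obtain ⟨ρ₁, hρ₁, h₁⟩ := ih (fun k hk => hlt k (by omega)) (fun k hk => hd k (by omega))
      (lt_min hr hρ₂) (half_pos hδ)
    refine ⟨ρ₁, hρ₁, ?_⟩
    filter_upwards [h₁, h₂, eventually_ge_atTop 0] with T h₁ h₂ hT C hC hCsub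
    have b₁ := h₁ C hC hCsub
    have b₂ := h₂ (C ∩ chainEvent Z f s K T (min r ρ₂))
      ((pastSigma_mono (mul_le_mul_of_nonneg_right (hs (Nat.zero_le K)) hT) _ hC).inter
        (measurableSet_chainEvent f hs K hT _))
      (inter_subset_right.trans ((chainEvent_subset f s le_rfl _ _).trans
        (nearEvent_mono (min_le_right _ _))))
    calc _ = ENNReal.ofReal (Real.exp (-(T * ((s (K + 1) - s K) * d K + δ / 2)))) *
          (ENNReal.ofReal (Real.exp (-(T * (∑ k ∈ Finset.range K, (s (k + 1) - s k) * d k +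
            δ / 2)))) * P C) := by
          rw [← mul_assoc, ← ENNReal.ofReal_mul (Real.exp_nonneg _), ← Real.exp_add,
            Finset.sum_range_succ]
          congr 3
          ring
      _ ≤ _ := mul_le_mul_right b₁ _
      _ ≤ _ := b₂
      _ ≤ _ := by
          rw [chainEvent_succ, ← inter_assoc]
          exact measure_mono (inter_subset_inter_left _ (inter_subset_inter_right _
            (chainEvent_mono f s K T (min_le_left _ _))))

end Chain

/-! ### Finite rates and special partitions. -/

section Partitions

lemma EReal.finsetSum_ne_bot {ι : Type*} {s : Finset ι} {x : ι → EReal}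
    (hx : ∀ k ∈ s, x k ≠ ⊥) : ∑ k ∈ s, x k ≠ ⊥ := by
  classical
  induction s using Finset.induction_on with
  | empty => simp
  | insert i s hi ih =>
    rw [Finset.sum_insert hi, Ne, EReal.add_eq_bot_iff, not_or]
    exact ⟨hx i (Finset.mem_insert_self _ _), ih fun k hk => hx k (Finset.mem_insert_of_mem hk)⟩

/-- A term `⊤` would make the sum `⊤`, since no other term is `⊥`. -/
lemma EReal.exists_real_of_sum_range_le {n : ℕ} {x : ℕ → EReal} (hx : ∀ k < n, x k ≠ ⊥) {c : ℝ}
    (hc : ∑ k ∈ Finset.range n, x k ≤ c) :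
    ∃ y : ℕ → ℝ, (∀ k < n, x k = y k) ∧ ∑ k ∈ Finset.range n, y k ≤ c := by
  have htop : ∀ k < n, x k ≠ ⊤ := by
    intro k hk h
    rw [← Finset.add_sum_erase _ _ (Finset.mem_range.2 hk), h, EReal.top_add_of_ne_bot] at hc
    · exact (EReal.coe_lt_top c).not_ge hc
    · exact EReal.finsetSum_ne_bot fun j hj =>
        hx j (Finset.mem_range.1 (Finset.mem_of_mem_erase hj))
  refine ⟨fun k => (x k).toReal, fun k hk => (EReal.coe_toReal (htop k hk) (hx k hk)).symm, ?_⟩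
  rw [← EReal.coe_le_coe_iff, EReal.coe_finsetSum]
  refine le_trans (le_of_eq (Finset.sum_congr rfl fun k hk => ?_)) hc
  have hk := Finset.mem_range.1 hk
  exact EReal.coe_toReal (htop k hk) (hx k hk)

lemma deviationSum_ne_bot {A : ℝ → EReal} (hA : IsEssentiallySmoothConvex A) (f : ℝ → ℝ)
    (π : UnitPartition) : deviationSum (legendre A) f π ≠ ⊥ := by
  rw [deviationSum_eq]
  exact EReal.finsetSum_ne_bot fun k hk => incrCost_ne_bot hA f (π.seq_lt (Finset.mem_range.1 hk))

lemma exists_real_rates {A : ℝ → EReal} (hA : IsEssentiallySmoothConvex A) (f : ℝ → ℝ)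
    (π : UnitPartition) {c : ℝ} (hc : deviationSum (legendre A) f π ≤ c) :
    ∃ d : ℕ → ℝ, (∀ k < π.n, legendre A ((f (π.seq (k + 1)) - f (π.seq k)) /
        (π.seq (k + 1) - π.seq k)) ≤ d k) ∧
      ∑ k ∈ Finset.range π.n, (π.seq (k + 1) - π.seq k) * d k ≤ c := by
  rw [deviationSum_eq] at hc
  obtain ⟨y, hy, hsum⟩ := EReal.exists_real_of_sum_range_le
    (fun k hk => incrCost_ne_bot hA f (π.seq_lt hk)) hc
  refine ⟨fun k => y k / (π.seq (k + 1) - π.seq k), fun k hk => ?_, ?_⟩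
  · have hpos : 0 < π.seq (k + 1) - π.seq k := sub_pos.2 (π.seq_lt hk)
    have h := hy k hk
    unfold incrCost at h
    generalize legendre A _ = D at h
    induction D with
    | bot => exact bot_le
    | top =>
      rw [EReal.coe_mul_top_of_pos hpos] at h
      exact absurd h.symm (EReal.coe_ne_top _)
    | coe D =>
      rw [← EReal.coe_mul, EReal.coe_eq_coe_iff] at h
      rw [EReal.coe_le_coe_iff, le_div_iff₀ hpos, ← h, mul_comm]
  · refine le_trans (le_of_eq (Finset.sum_congr rfl fun k hk => ?_)) hsum
    exact mul_div_cancel₀ _ (sub_pos.2 (π.seq_lt (Finset.mem_range.1 hk))).ne'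

/-- The partition into `N` intervals of equal length. -/
def uniformPartition (N : ℕ) (hN : 0 < N) : UnitPartition where
  n := N
  pt k := (k : ℝ) / N
  strictMono i j hij := by
    have : (0 : ℝ) < N := by exact_mod_cast hN
    have h : ((i : ℕ) : ℝ) < ((j : ℕ) : ℝ) := by exact_mod_cast hij
    exact div_lt_div_of_pos_right h this
  pt_zero := by simp
  pt_last := by
    have : (N : ℝ) ≠ 0 := by exact_mod_cast hN.ne'
    simp [this]

lemma uniformPartition_seq {N : ℕ} (hN : 0 < N) {k : ℕ} (hk : k ≤ N) :
    (uniformPartition N hN).seq k = (k : ℝ) / N := by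
  simp only [UnitPartition.seq, uniformPartition]
  rw [min_eq_left hk]

/-- Any two points of `[0,1]` belong to a common partition. -/
lemma exists_partition_through {u v : ℝ} (hu : u ∈ Icc (0 : ℝ) 1) (hv : v ∈ Icc (0 : ℝ) 1) :
    ∃ π : UnitPartition, (∃ i ≤ π.n, π.seq i = u) ∧ ∃ j ≤ π.n, π.seq j = v := by
  -- A `Finset` merges coincidences among these points before they are sorted.
  set F : Finset ℝ := {0, 1, u, v} with hF
  have hne : F.Nonempty := ⟨0, by simp [hF]⟩
  obtain ⟨n, hn⟩ := Nat.exists_eq_succ_of_ne_zero hne.card_pos.ne'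
  have hbd : ∀ x ∈ F, x ∈ Icc (0 : ℝ) 1 := by
    intro x hx
    simp only [hF, Finset.mem_insert, Finset.mem_singleton] at hx
    rcases hx with rfl | rfl | rfl | rfl <;> simp_all
  let e := F.orderEmbOfFin hn
  have hsurj : ∀ x ∈ F, ∃ k, e k = x := fun x hx => by
    have : x ∈ Set.range e := by rw [Finset.range_orderEmbOfFin]; exact hx
    exact this
  have hmem : ∀ k, e k ∈ F := Finset.orderEmbOfFin_mem F hn
  let π : UnitPartition :=
    { n := n
      pt := e
      strictMono := e.strictMono
      pt_zero := by
        obtain ⟨k, hk⟩ := hsurj 0 (by simp [hF])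
        exact le_antisymm (hk ▸ e.monotone (Fin.zero_le k)) (hbd _ (hmem _)).1
      pt_last := by
        obtain ⟨k, hk⟩ := hsurj 1 (by simp [hF])
        exact le_antisymm (hbd _ (hmem _)).2 (hk ▸ e.monotone (Fin.le_last k)) }
  have hseq : ∀ k : Fin (n + 1), π.seq k = e k := by
    intro k
    have : min (k : ℕ) n = k := min_eq_left (Nat.lt_succ_iff.1 k.2)
    simp only [UnitPartition.seq, π, this]
  obtain ⟨i, hi⟩ := hsurj u (by simp [hF])
  obtain ⟨j, hj⟩ := hsurj v (by simp [hF])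
  exact ⟨π, ⟨i, Nat.lt_succ_iff.1 i.2, (hseq i).trans hi⟩,
    ⟨j, Nat.lt_succ_iff.1 j.2, (hseq j).trans hj⟩⟩

end Partitions

/-! ### Uniform neighbourhoods and diagonal indices. -/

section Neighbourhoods

lemma abs_sub_lt_of_mem_uniformNhd {f g : ℝ → ℝ} {ε : ℝ} (h : g ∈ uniformNhd f ε) {s : ℝ}
    (hs : s ∈ Icc (0 : ℝ) 1) : |g s - f s| < ε := by
  have h1 := (le_iSup₂ (f := fun s (_ : s ∈ Icc (0 : ℝ) 1) => edist (g s) (f s)) s hs).trans_lt h.2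
  rw [edist_dist, Real.dist_eq] at h1
  exact ENNReal.lt_ofReal_iff_toReal_lt ENNReal.ofReal_ne_top |>.1 h1 |>.trans_eq' (by simp)

lemma mem_uniformNhd_of_abs_sub_le {f g : ℝ → ℝ} {ε ε' : ℝ} (hε : 0 < ε) (hεε' : ε' < ε)
    (hg : IsCadlagUnit g) (h : ∀ s ∈ Icc (0 : ℝ) 1, |g s - f s| ≤ ε') : g ∈ uniformNhd f ε := by
  refine ⟨hg, lt_of_le_of_lt (iSup₂_le fun s hs => ?_)
    ((ENNReal.ofReal_lt_ofReal_iff hε).2 hεε')⟩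
  rw [edist_dist, Real.dist_eq]
  exact ENNReal.ofReal_le_ofReal (h s hs)

lemma uniformNhd_mono (f : ℝ → ℝ) {ε ε' : ℝ} (h : ε ≤ ε') : uniformNhd f ε ⊆ uniformNhd f ε' :=
  fun _ hg => ⟨hg.1, hg.2.trans_le (ENNReal.ofReal_le_ofReal h)⟩

lemma IsCadlag.isCadlagUnit_scaled {x : ℝ → ℝ} (hx : IsCadlag x) {T : ℝ} (hT : 0 < T) :
    IsCadlagUnit (fun s => x (s * T) / T) := by
  constructor
  · intro t _
    refine ContinuousWithinAt.div_const ?_ T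
    refine (hx (t * T)).1.comp (f := fun s => s * T) (by fun_prop) fun s hs => ?_
    exact mul_le_mul_of_nonneg_right (mem_Ici.1 hs) hT.le
  · intro t _
    obtain ⟨l, hl⟩ := (hx (t * T)).2
    refine ⟨l / T, Tendsto.div_const (hl.comp (tendsto_nhdsWithin_iff.2 ⟨?_, ?_⟩)) T⟩
    · exact ((continuous_mul_const T).tendsto t).mono_left nhdsWithin_le_nhds
    · filter_upwards [self_mem_nhdsWithin] with s hs
      exact mul_lt_mul_of_pos_right (mem_Iio.1 hs) hT

end Neighbourhoods

/-- Countably many eventual properties hold eventually along an index tending to infinity. -/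
lemma exists_index_tendsto_atTop {Q : ℕ → ℝ → Prop} (h : ∀ n, ∀ᶠ T in atTop, Q n T) :
    ∃ m : ℝ → ℕ, Tendsto m atTop atTop ∧ ∀ᶠ T in atTop, Q (m T) T := by
  classical
  choose τ hτ using fun n => eventually_atTop.1 (h n)
  set m : ℝ → ℕ := fun T => Nat.findGreatest (fun n => τ n ≤ T) ⌊T⌋₊
  refine ⟨m, tendsto_atTop.2 fun N => ?_, ?_⟩
  · filter_upwards [eventually_ge_atTop (τ N), eventually_ge_atTop (N : ℝ)] with T h1 h2
    exact Nat.le_findGreatest (Nat.le_floor h2) h1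
  · filter_upwards [eventually_ge_atTop (τ 0)] with T hT
    exact hτ _ _ (Nat.findGreatest_spec (P := fun n => τ n ≤ T) (Nat.zero_le _) hT)

lemma measurableSet_nearEvent_zero {Ω : Type*} {Z : ℝ → Ω → ℝ} (α T r : ℝ) :
    MeasurableSet[pastSigma Z 0] (nearEvent Z 0 α T r) :=
  pastSigma_mono (zero_mul T).le _ (measurableSet_nearEvent 0 α T r)

lemma UnitPartition.pastSigma_zero_le {Ω : Type*} (Z : ℝ → Ω → ℝ) (π : UnitPartition) (T : ℝ) :
    pastSigma Z 0 ≤ pastSigma Z (π.seq 0 * T) :=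
  pastSigma_mono (by rw [π.seq_zero, zero_mul])

/-! ### The upper and lower bounds for neighbourhoods of `f`. -/

section Main

variable {Ω : Type*} [MeasurableSpace Ω] {P : Measure Ω} [IsProbabilityMeasure P]
  {Z : ℝ → Ω → ℝ} {A : ℝ → EReal} {f : ℝ → ℝ}

/-- The upper bound holds for every radius tending to zero. -/
theorem uniformLimsupLE_condLogProb (hZ : ∀ t, Measurable (Z t)) (hA : ConditionA P Z A)
    {η ε : ℝ → ℝ} (hη : IsPosNull η) (hε : IsPosNull ε) :
    UniformLimsupLE P (fun T => condLogProb P Z f (ε T) T)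
      (fun T => nearEvent Z 0 (f 0) T (η T)) (-⨆ π, deviationSum (legendre A) f π) := by
  intro b hb
  induction b with
  | bot => exact absurd hb not_lt_bot
  | top => exact Eventually.of_forall fun T => Eventually.of_forall fun ω _ => le_top
  | coe b =>
  obtain ⟨π, hπ⟩ := lt_iSup_iff.1 (EReal.neg_lt_comm.1 hb)
  obtain ⟨μ, hμ, hbμ⟩ := exists_slopes_of_lt_deviationSum hA.smooth.ne_bot f π hπ
  rw [← EReal.coe_neg, EReal.coe_lt_coe_iff, neg_lt_iff_pos_add] at hbμ
  -- The slack `hbμ` is spent as the error of the chain bound, so the exponent becomes exactly `T *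
  -- b`.
  obtain ⟨ρ, hρ, h⟩ := hA.exists_chain_upper hZ f π.seq_mono π.seq_zero.ge π.n
    (fun k hk => π.seq_lt hk) hμ hbμ
  simp only [add_sub_cancel_left, π.seq_zero] at h
  filter_upwards [h, hη.2.eventually_lt_const hρ, hε.2.eventually_lt_const hρ,
    eventually_gt_atTop 0] with T hT hηT hεT hTpos
  have hN : MeasurableSet[pastSigma Z 0] (nearEvent Z 0 (f 0) T (η T)) :=
    measurableSet_nearEvent_zero _ _ _
  have key := condLExp_le_of_setLIntegral_le (P := P)
    (X := {ω' | scaledPath Z T ω' ∈ uniformNhd f (ε T)}.indicator 1)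
    (pastSigma_le hZ 0) hN (c := ENNReal.ofReal (Real.exp (T * b))) fun C hC hCsub => by
      have hch := pastSigma_le hZ _ _ (measurableSet_chainEvent f π.seq_mono π.n hTpos.le ρ)
      refine le_trans ?_ (hT C (π.pastSigma_zero_le Z T _ hC) (hCsub.trans (nearEvent_mono hηT.le)))
      rw [inter_comm, ← Measure.restrict_apply hch, ← lintegral_indicator_one hch]
      -- Pointwise comparison with the measurable chain event avoids any measurability of the
      -- neighbourhood event.
      refine lintegral_mono (indicator_le_indicator_of_subset (fun ω hω => ?_) (by simp))
      refine mem_iInter₂.2 fun j _ => ?_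
      exact (abs_sub_lt_of_mem_uniformNhd hω (π.seq_mem j)).trans hεT
  filter_upwards [key] with ω hω hωN
  exact (inv_mul_log_le_iff hTpos _).2 (hω hωN)

/-- If the deviation integral of `f` is finite and the conditioning events are not eventually
negligible, then `f` inherits the modulus of continuity of the trajectories. -/
lemma abs_sub_le_of_frequently_ne_zero (hZ : ∀ t, Measurable (Z t)) (hA : ConditionA P Z A)
    {J : ℝ} (hJ : ∀ π, deviationSum (legendre A) f π ≤ J) {η : ℝ → ℝ} (hη : IsPosNull η)
    (hfreq : ∃ᶠ T in atTop, P (nearEvent Z 0 (f 0) T (η T)) ≠ 0) {V W : ℝ → ℝ}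
    (hV : V =o[atTop] (fun t => t))
    (hB : ∀ T > 0, ∀ δ > 0, ∀ᵐ ω ∂P, ∀ u v : ℝ, 0 ≤ u → u < v → v ≤ min (u + δ) 1 →
      |Z (u * T) ω - Z (v * T) ω| ≤ V T + W δ * T)
    {u v δ : ℝ} (hu : 0 ≤ u) (huv : u < v) (hv : v ≤ 1) (hδ : 0 < δ) (hvδ : v ≤ u + δ) :
    |f u - f v| ≤ W δ := by
  refine le_of_forall_pos_le_add fun κ hκ => ?_
  obtain ⟨π, ⟨i, hi, rfl⟩, ⟨j, hj, rfl⟩⟩ :=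
    exists_partition_through (u := u) (v := v) ⟨hu, huv.le.trans hv⟩ ⟨hu.trans huv.le, hv⟩
  obtain ⟨d, hd, -⟩ := exists_real_rates hA.smooth f π (hJ π)
  obtain ⟨ρ, hρ, h⟩ := hA.exists_chain_lower hZ f π.seq_mono π.seq_zero.ge π.n
    (fun k hk => π.seq_lt hk) hd (r := κ / 3) (by positivity) one_pos
  simp only [π.seq_zero] at h
  obtain ⟨T, hPT, hT, hηT, hVT, hTpos⟩ := (hfreq.and_eventually (h.and
    ((hη.2.eventually_lt_const hρ).and ((hV.def (show 0 < κ / 3 by positivity)).and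
      (eventually_gt_atTop 0))))).exists
  have hN : MeasurableSet[pastSigma Z 0] (nearEvent Z 0 (f 0) T (η T)) :=
    measurableSet_nearEvent_zero _ _ _
  -- Any positive probability suffices: it yields one path that is close to `f` at both points and
  -- obeys the oscillation bound.
  have hpos : P (nearEvent Z 0 (f 0) T (η T) ∩ chainEvent Z f π.seq π.n T (κ / 3)) ≠ 0 := by
    refine ne_of_gt (lt_of_lt_of_le ?_ (hT _ (π.pastSigma_zero_le Z T _ hN) (nearEvent_mono hηT.le)))
    exact ENNReal.mul_pos (ENNReal.ofReal_pos.2 (Real.exp_pos _)).ne' hPT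
  obtain ⟨ω, hω, hωB⟩ := ((frequently_ae_mem_iff.2 hpos).and_eventually (hB T hTpos δ hδ)).exists
  have b₁ : |Z (π.seq i * T) ω / T - f (π.seq i)| < κ / 3 := chainEvent_subset f π.seq hi T _ hω.2
  have b₂ : |Z (π.seq j * T) ω / T - f (π.seq j)| < κ / 3 := chainEvent_subset f π.seq hj T _ hω.2
  have b₃ := hωB _ _ hu huv (le_min hvδ hv)
  rw [Real.norm_eq_abs, Real.norm_eq_abs, abs_of_pos hTpos] at hVT
  have b₄ : |Z (π.seq i * T) ω / T - Z (π.seq j * T) ω / T| ≤ κ / 3 + W δ := by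
    rw [← sub_div, abs_div, abs_of_pos hTpos, div_le_iff₀ hTpos]
    linarith [le_abs_self (V T)]
  rw [abs_lt] at b₁ b₂
  rw [abs_le] at b₄ ⊢
  constructor <;> linarith [b₁.1, b₁.2, b₂.1, b₂.2, b₄.1, b₄.2]

/-- The lower bound for a fixed radius, in integrated form. -/
theorem eventually_le_setLIntegral_of_conditionB (hZ : ∀ t, Measurable (Z t))
    (hZp : ∀ ω, IsCadlag (fun t => Z t ω)) (hA : ConditionA P Z A) (hB : ConditionB P Z)
    {J : ℝ} (hJ : ∀ π, deviationSum (legendre A) f π ≤ J) {η : ℝ → ℝ} (hη : IsPosNull η)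
    {ε b : ℝ} (hε : 0 < ε) (hb : b < -J) :
    ∀ᶠ T in atTop, ∀ C, MeasurableSet[pastSigma Z 0] C → C ⊆ nearEvent Z 0 (f 0) T (η T) →
      ENNReal.ofReal (Real.exp (T * b)) * P C ≤
        ∫⁻ ω in C, {ω' | scaledPath Z T ω' ∈ uniformNhd f ε}.indicator 1 ω ∂P := by
  -- If the conditioning events are eventually null, the bound is trivial; otherwise `f` has the
  -- modulus `W`.
  by_cases hfreq : ∃ᶠ T in atTop, P (nearEvent Z 0 (f 0) T (η T)) ≠ 0
  swap
  · filter_upwards [not_frequently.1 hfreq] with T hT C _ hCsub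
    rw [measure_mono_null hCsub (not_not.1 hT), mul_zero]
    exact zero_le
  obtain ⟨V, W, -, hV, hWpos, hW, hB⟩ := hB
  have hWN : Tendsto (fun N : ℕ => W (1 / ((N : ℝ) + 1))) atTop (𝓝 0) :=
    hW.comp (tendsto_nhdsWithin_iff.2 ⟨tendsto_one_div_add_atTop_nhds_zero_nat,
      Eventually.of_forall fun N => mem_Ioi.2 (by positivity)⟩)
  -- Four errors of at most `ε / 8` add up to `ε / 2`: the grid window, `V T / T`, and `W δ` once
  -- for the path and once for `f`.
  obtain ⟨N, hN⟩ := (hWN.eventually_lt_const (show 0 < ε / 8 by positivity)).exists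
  set δ : ℝ := 1 / ((N : ℝ) + 1) with hδdef
  have hδ : 0 < δ := by positivity
  have hmod : ∀ u v, 0 ≤ u → u < v → v ≤ 1 → v ≤ u + δ → |f u - f v| ≤ W δ :=
    fun u v hu huv hv hvδ =>
      abs_sub_le_of_frequently_ne_zero hZ hA hJ hη hfreq hV hB hu huv hv hδ hvδ
  set π := uniformPartition (N + 1) N.succ_pos with hπ
  obtain ⟨d, hd, hdJ⟩ := exists_real_rates hA.smooth f π (hJ π)
  obtain ⟨ρ, hρ, h⟩ := hA.exists_chain_lower hZ f π.seq_mono π.seq_zero.ge π.n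
    (fun k hk => π.seq_lt hk) hd (r := ε / 8) (δ := -J - b) (by positivity) (by linarith)
  simp only [π.seq_zero] at h
  filter_upwards [h, hη.2.eventually_lt_const hρ, hV.def (show 0 < ε / 8 by positivity),
    eventually_gt_atTop 0] with T hT hηT hVT hTpos C hC hCsub
  rw [Real.norm_eq_abs, Real.norm_eq_abs, abs_of_pos hTpos] at hVT
  have hch := pastSigma_le hZ _ _
    (measurableSet_chainEvent (Z := Z) f π.seq_mono π.n hTpos.le (ε / 8))
  calc ENNReal.ofReal (Real.exp (T * b)) * P C
      ≤ ENNReal.ofReal (Real.exp (-(T * (∑ k ∈ Finset.range π.n,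
          (π.seq (k + 1) - π.seq k) * d k + (-J - b))))) * P C := by
        gcongr
        nlinarith [mul_le_mul_of_nonneg_left hdJ hTpos.le]
    _ ≤ P (C ∩ chainEvent Z f π.seq π.n T (ε / 8)) :=
        hT C (π.pastSigma_zero_le Z T _ hC) (hCsub.trans (nearEvent_mono hηT.le))
    _ = ∫⁻ ω in C, (chainEvent Z f π.seq π.n T (ε / 8)).indicator 1 ω ∂P := by
        rw [lintegral_indicator_one hch, Measure.restrict_apply hch, inter_comm]
    _ ≤ _ := by
        refine lintegral_mono_ae (ae_restrict_of_ae ?_)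
        filter_upwards [hB T hTpos δ hδ] with ω hω
        by_cases hωc : ω ∈ chainEvent Z f π.seq π.n T (ε / 8)
        swap
        · rw [indicator_of_notMem hωc]; exact zero_le
        rw [indicator_of_mem hωc, indicator_of_mem]
        refine mem_uniformNhd_of_abs_sub_le hε (ε' := ε / 2) (by linarith)
          ((hZp ω).isCadlagUnit_scaled hTpos) fun s hs => ?_
        change |Z (s * T) ω / T - f s| ≤ ε / 2
        have hNpos : (0 : ℝ) < (N : ℝ) + 1 := by positivity
        have hkN : ⌊s * ((N : ℝ) + 1)⌋₊ ≤ N + 1 := by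
          refine Nat.floor_le_of_le ?_
          push_cast
          nlinarith [hs.2]
        set k := ⌊s * ((N : ℝ) + 1)⌋₊ with hk
        have hfl := Nat.floor_le (mul_nonneg hs.1 hNpos.le)
        have hfl' := Nat.lt_floor_add_one (s * ((N : ℝ) + 1))
        rw [← hk] at hfl hfl'
        set u := π.seq k with hu
        have huk : u = (k : ℝ) / ((N : ℝ) + 1) := by
          rw [hu, hπ, uniformPartition_seq N.succ_pos hkN]; push_cast; rfl
        have hus : u ≤ s := by rw [huk, div_le_iff₀ hNpos]; exact hfl
        have hsu : s ≤ u + δ := by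
          rw [huk, hδdef, ← add_div, le_div_iff₀ hNpos]; exact hfl'.le
        have hnear : |Z (u * T) ω / T - f u| < ε / 8 :=
          chainEvent_subset f π.seq hkN T _ hωc
        rcases hus.eq_or_lt with hus' | hus'
        · rw [← hus']; linarith
        have b₁ := hω u s (π.seq_mem k).1 hus' (le_min hsu hs.2)
        have b₂ := hmod u s (π.seq_mem k).1 hus' hs.2 hsu
        have b₃ : |Z (u * T) ω / T - Z (s * T) ω / T| ≤ ε / 8 + W δ := by
          rw [← sub_div, abs_div, abs_of_pos hTpos, div_le_iff₀ hTpos]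
          linarith [le_abs_self (V T)]
        rw [abs_lt] at hnear
        rw [abs_le] at b₂ b₃ ⊢
        constructor <;> linarith [hnear.1, hnear.2, b₂.1, b₂.2, b₃.1, b₃.2]

/-- The lower bound holds for radii tending to zero slowly enough. -/
theorem exists_uniformLiminfGE_condLogProb (hZ : ∀ t, Measurable (Z t))
    (hZp : ∀ ω, IsCadlag (fun t => Z t ω)) (hA : ConditionA P Z A) (hB : ConditionB P Z)
    {η : ℝ → ℝ} (hη : IsPosNull η) :
    ∃ ε' : ℝ → ℝ, IsPosNull ε' ∧ ∀ ε : ℝ → ℝ, (∃ c > 0, ∀ᶠ T in atTop, c * ε' T ≤ ε T) →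
      UniformLiminfGE P (fun T => condLogProb P Z f (ε T) T)
        (fun T => nearEvent Z 0 (f 0) T (η T)) (-⨆ π, deviationSum (legendre A) f π) := by
  set J := ⨆ π, deviationSum (legendre A) f π with hJdef
  have hJle : ∀ π, deviationSum (legendre A) f π ≤ J := le_iSup _
  clear_value J
  induction J with
  | bot => exact absurd (le_bot_iff.1 (hJle (uniformPartition 1 one_pos))) (deviationSum_ne_bot hA.smooth f _)
  | top => exact ⟨η, hη, fun ε _ b hb => absurd hb (by simp)⟩
  | coe J =>
  obtain ⟨m, hm, hmQ⟩ := exists_index_tendsto_atTop fun n : ℕ =>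
    eventually_le_setLIntegral_of_conditionB hZ hZp hA hB hJle hη
      (ε := 1 / ((n : ℝ) + 1)) (b := -J - 1 / ((n : ℝ) + 1)) (by positivity)
      (by have : (0 : ℝ) < 1 / ((n : ℝ) + 1) := by positivity
          linarith)
  have hm1 : Tendsto (fun T => (m T : ℝ) + 1) atTop atTop :=
    tendsto_atTop_add_const_right _ _ (tendsto_natCast_atTop_atTop.comp hm)
  have hsqrt : Tendsto (fun T => √((m T : ℝ) + 1)) atTop atTop := Real.tendsto_sqrt_atTop.comp hm1
  -- The square root absorbs constants: for every `c > 0`, eventually `c / √(m + 1) ≥ 1 / (m + 1)`,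
  -- the radius for which the bound is known.
  refine ⟨fun T => 1 / √((m T : ℝ) + 1), ⟨fun T => by positivity, ?_⟩, ?_⟩
  · exact tendsto_const_nhds.div_atTop hsqrt
  rintro ε ⟨c, hc, hcε⟩ b hb
  induction b with
  | bot => exact Eventually.of_forall fun T => Eventually.of_forall fun ω _ => bot_le
  | top => exact absurd hb not_top_lt
  | coe b =>
  rw [← EReal.coe_neg, EReal.coe_lt_coe_iff] at hb
  filter_upwards [hmQ, hcε, hsqrt.eventually_ge_atTop (1 / c),
    hm1.eventually_ge_atTop (1 / (-J - b)), eventually_gt_atTop 0] with T hQ hcT hsT hmT hTpos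
  have hMpos : (0 : ℝ) < (m T : ℝ) + 1 := by positivity
  have hε : 1 / ((m T : ℝ) + 1) ≤ ε T := by
    refine le_trans ?_ hcT
    have hs := Real.sqrt_pos.2 hMpos
    rw [div_le_iff₀ hc] at hsT
    rw [mul_one_div, div_le_div_iff₀ hMpos hs, one_mul]
    nth_rewrite 2 [← Real.mul_self_sqrt hMpos.le]
    nlinarith
  have hbm : b ≤ -J - 1 / ((m T : ℝ) + 1) := by
    have : 1 / ((m T : ℝ) + 1) ≤ -J - b := by
      rw [div_le_iff₀ (by linarith)] at hmT
      rw [div_le_iff₀ hMpos]; linarith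
    linarith
  have hN : MeasurableSet[pastSigma Z 0] (nearEvent Z 0 (f 0) T (η T)) :=
    measurableSet_nearEvent_zero _ _ _
  have key := le_condLExp_of_le_setLIntegral (P := P)
    (X := {ω' | scaledPath Z T ω' ∈ uniformNhd f (ε T)}.indicator 1)
    (pastSigma_le hZ 0) hN (c := ENNReal.ofReal (Real.exp (T * b))) fun C hC hCsub => by
      refine le_trans ?_ ((hQ C hC hCsub).trans ?_)
      · gcongr
      · exact lintegral_mono (indicator_le_indicator_of_subset
          (fun ω hω => uniformNhd_mono f hε hω) (by simp))
  filter_upwards [key] with ω hω hωN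
  exact (le_inv_mul_log_iff hTpos _).2 (hω hωN)

end Main

end

theorem theorem3p2 {Ω : Type*} [MeasurableSpace Ω] (P : Measure Ω) [IsProbabilityMeasure P]
    (Z : ℝ → Ω → ℝ) (hZ_meas : ∀ t, Measurable (Z t)) (hZ_path : ∀ ω, IsCadlag (fun t => Z t ω))
    (A : ℝ → EReal) (hA : ConditionA P Z A) (f : ℝ → ℝ) (hf : IsCadlagUnit f) :
    ∃ J : EReal, HasDeviationIntegral (legendre A) f J ∧
      (∀ η : ℝ → ℝ, IsPosNull η → HoldsForSlow (fun ε =>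
        UniformLimsupLE P (fun T => condLogProb P Z f (ε T) T)
          (fun T => nearEvent Z 0 (f 0) T (η T)) (-J))) ∧
      (ConditionB P Z → ∀ η : ℝ → ℝ, IsPosNull η → HoldsForSlow (fun ε =>
        UniformLim P (fun T => condLogProb P Z f (ε T) T)
          (fun T => nearEvent Z 0 (f 0) T (η T)) (-J))) := by
  refine ⟨⨆ π, deviationSum (legendre A) f π, hasDeviationIntegral_iSup hA.smooth.ne_bot hf,
    fun η hη => ?_, fun hB η hη => ?_⟩
  · exact ⟨η, hη, uniformLimsupLE_condLogProb hZ_meas hA hη hη,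
      fun ε hε _ => uniformLimsupLE_condLogProb hZ_meas hA hη hε⟩
  · obtain ⟨ε', hε', h⟩ := exists_uniformLiminfGE_condLogProb (f := f) hZ_meas hZ_path hA hB hη
    exact ⟨ε', hε', ⟨uniformLimsupLE_condLogProb hZ_meas hA hη hε',
        h ε' ⟨1, one_pos, Eventually.of_forall fun T => (one_mul _).le⟩⟩,
      fun ε hε hc => ⟨uniformLimsupLE_condLogProb hZ_meas hA hη hε, h ε hc⟩⟩
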